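/- Let $\lambda>0$, let $d\mu(x)=x^{2\lambda}\,dx$ on $\mathbb{R}_+=(0,\infty)$, let $\triangle_\lambda=-\frac{d^2}{dx^2}-\frac{2\lambda}{x}\frac{d}{dx}$ be the Bessel operator, understood as the non-negative self-adjoint operator on $L^2(\mathbb{R}_+,\mu)$ associated with the closed quadratic form $u\mapsto\int_0^\infty|u'|^2\,d\mu$ with domain $\{u\in L^2(\mu): u \text{ locally absolutely continuous on } (0,\infty),\ u'\in L^2(\mu)\}$, and let $R_\lambda=\frac{d}{dx}\triangle_\lambda^{-1/2}$ be the Bessel Riesz transform. Let $\mathrm{BMO}_{\triangle_\lambda}(\mathbb{R}_+)$ be the space of functions $b$ that are locally integrable with respect to $\mu$ and satisfy $$\sup_{B}\frac1{\mu(B)}\int_B|b-b_B|\,d\mu<\infty,\qquad b_B=\frac1{\mu(B)}\int_B b\,d\mu,$$ where the supremum is over all bounded intervals $B=(p,q)\subset\mathbb{R}_+$. For $f$ bounded, measurable and compactly supported in $(0,\infty)$ put $[b,R_\lambda]f=b\,R_\lambda f-R_\lambda(bf)$. Then the function $b_0(x)=\log x^{2\lambda}$ belongs to $\mathrm{BMO}_{\triangle_\lambda}(\mathbb{R}_+)$,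 and $[b_0,R_\lambda]$ is not of weak type $(1,1)$: there is no constant $C<\infty$ such that $$\mu(\{x>0:|[b_0,R_\lambda]f(x)|>t\})\le\frac Ct\int_0^\infty|f|\,d\mu$$ for all $t>0$ and all bounded measurable $f$ with compact support in $(0,\infty)$. -/

import Mathlib

open MeasureTheory Set
open scoped NNReal ENNReal

noncomputable section

/-- The measure `dμ(x) = x ^ (2 λ) dx` on the half-line `(0, ∞)`, as a measure on `ℝ` that does not
charge `(-∞, 0]`. -/
def besselMeasure (lam : ℝ) : Measure ℝ :=
  (volume.restrict (Ioi 0)).withDensity fun x => ENNReal.ofReal (x ^ (2 * lam))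

/-- `u` belongs to the energy space of the Bessel operator and `du` is its derivative: `u` and `du`
lie in `L²(μ)` and `u` is, on `(0, ∞)`, the locally absolutely continuous function with derivative
`du`. (As `du ∈ L²(μ)`, the function `du` is integrable on compact subintervals of `(0, ∞)`.) -/
structure HasEnergyDeriv (lam : ℝ) (u du : ℝ → ℝ) : Prop where
  memLp : MemLp u 2 (besselMeasure lam)
  memLp_deriv : MemLp du 2 (besselMeasure lam)
  sub_eq : ∀ a b : ℝ, 0 < a → 0 < b → u b - u a = ∫ x in a..b, du x

/-- `(s + Δ) u = f` for the Bessel operator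
`Δ u = - u'' - (2 λ / x) u' = - x ^ (-2 λ) (x ^ (2 λ) u')'`, taken as the self-adjoint operator in
`L²(μ)` of the closed quadratic form `u ↦ ∫ |u'|² dμ`, with domain the energy space:
`∫ u' v' dμ + s ∫ u v dμ = ∫ f v dμ` for all `v` in the energy space. -/
def SolvesBesselResolvent (lam s : ℝ) (f u : ℝ → ℝ) : Prop :=
  ∃ du : ℝ → ℝ, HasEnergyDeriv lam u du ∧
    ∀ v dv : ℝ → ℝ, HasEnergyDeriv lam v dv →
      (∫ x, du x * dv x ∂(besselMeasure lam)) + s * (∫ x, u x * v x ∂(besselMeasure lam))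
        = ∫ x, f x * v x ∂(besselMeasure lam)

open Classical in
/-- The resolvent `(s + Δ)⁻¹ f`, for `s > 0` and `f ∈ L²(μ)`, as a continuous function on `(0, ∞)`.
(The solution is unique on `(0, ∞)`, see `SolvesBesselResolvent.eqOn`; the values outside `(0, ∞)`
play no role.) -/
def besselResolvent (lam s : ℝ) (f : ℝ → ℝ) : ℝ → ℝ :=
  if h : ∃ u : ℝ → ℝ, SolvesBesselResolvent lam s f u then h.choose else 0

/-- The fractional power `Δ ^ (-1/2)`, through Balakrishnan's formula
`Δ ^ (-1/2) f = (1 / π) ∫_0^∞ s ^ (-1/2) (s + Δ)⁻¹ f ds`. For `f ∈ L²(μ)` with compact support the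
integral converges absolutely at every point of `(0, ∞)`. -/
def besselInvSqrt (lam : ℝ) (f : ℝ → ℝ) (x : ℝ) : ℝ :=
  (1 / Real.pi) * ∫ s in Ioi (0 : ℝ), s ^ (-(1 / 2) : ℝ) * besselResolvent lam s f x

/-- The Bessel Riesz transform `R f = d/dx Δ ^ (-1/2) f`, for `f ∈ L²(μ)` with compact support;
the derivative exists at almost every point of `(0, ∞)`. -/
def besselRiesz (lam : ℝ) (f : ℝ → ℝ) (x : ℝ) : ℝ :=
  deriv (besselInvSqrt lam f) x

/-- The commutator `[b, R] f = b R f - R (b f)`. -/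
def besselCommutator (lam : ℝ) (b f : ℝ → ℝ) (x : ℝ) : ℝ :=
  b x * besselRiesz lam f x - besselRiesz lam (fun y => b y * f y) x

/-- The space `BMO` of the Bessel operator: functions that are locally integrable with respect to
`μ` and have bounded mean oscillation with respect to `μ` over the intervals
`B = (p, q) ⊆ (0, ∞)`. -/
def MemBesselBMO (lam : ℝ) (b : ℝ → ℝ) : Prop :=
  (∀ p q : ℝ, 0 ≤ p → p < q → IntegrableOn b (Ioo p q) (besselMeasure lam)) ∧
  ∃ C : ℝ, ∀ p q : ℝ, 0 ≤ p → p < q →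
    (⨍ x in Ioo p q, |b x - ⨍ y in Ioo p q, b y ∂(besselMeasure lam)| ∂(besselMeasure lam)) ≤ C

/-- The class on which weak type bounds are tested, dense in `L¹(μ)`: bounded measurable functions
with compact support in `(0, ∞)`. -/
def IsBddCompactSupp (f : ℝ → ℝ) : Prop :=
  Measurable f ∧ (∃ M : ℝ, ∀ x, |f x| ≤ M) ∧
    ∃ p q : ℝ, 0 < p ∧ ∀ x, x ∉ Icc p q → f x = 0

/-- `T` is of weak type `(1, 1)` with respect to `μ`:
`μ {|T f| > t} ≤ (C / t) ∫ |f| dμ` for all `t > 0` and all `f` in the class above. -/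
def IsBesselWeakTypeOne (lam : ℝ) (T : (ℝ → ℝ) → ℝ → ℝ) : Prop :=
  ∃ C : ℝ≥0, ∀ f : ℝ → ℝ, IsBddCompactSupp f → ∀ t : ℝ, 0 < t →
    besselMeasure lam {x | t < |T f x|}
      ≤ C * (∫⁻ x, ENNReal.ofReal |f x| ∂(besselMeasure lam)) / ENNReal.ofReal t

/-- On compact subintervals of `(0, ∞)` the derivative in the energy space is integrable. -/
theorem HasEnergyDeriv.intervalIntegrable {lam : ℝ} {u du : ℝ → ℝ}
    (h : HasEnergyDeriv lam u du) {a b : ℝ} (ha : 0 < a) (hb : 0 < b) :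
    IntervalIntegrable du volume a b := by
  have hpos : ∀ x ∈ uIcc a b, 0 < x := fun x hx => lt_of_lt_of_le (lt_min ha hb) hx.1
  have hcont : ContinuousOn (fun x : ℝ => x ^ (2 * lam)) (uIcc a b) := fun x hx =>
    (Real.continuousAt_rpow_const x _ (Or.inl (hpos x hx).ne')).continuousWithinAt
  obtain ⟨x₀, hx₀, hmin⟩ := isCompact_uIcc.exists_isMinOn nonempty_uIcc hcont
  have hc : 0 < x₀ ^ (2 * lam) := Real.rpow_pos_of_pos (hpos x₀ hx₀) _
  set c : ℝ≥0∞ := ENNReal.ofReal (x₀ ^ (2 * lam)) with hcdef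
  have hc0 : c ≠ 0 := by simpa [hcdef] using hc
  have hle : c • volume.restrict (uIcc a b) ≤ besselMeasure lam := by
    rw [← withDensity_const, besselMeasure]
    have h1 : (volume.restrict (uIcc a b)).withDensity (fun _ => c)
        ≤ (volume.restrict (uIcc a b)).withDensity fun x => ENNReal.ofReal (x ^ (2 * lam)) := by
      apply withDensity_mono
      filter_upwards [ae_restrict_mem measurableSet_uIcc] with x hx
      exact ENNReal.ofReal_le_ofReal (hmin hx)
    refine h1.trans ?_
    refine Measure.le_iff.2 fun S hS => ?_
    rw [withDensity_apply _ hS, withDensity_apply _ hS]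
    exact lintegral_mono' (Measure.restrict_mono_measure
      (Measure.restrict_mono_set _ fun x hx => hpos x hx) S) le_rfl
  have h2 : MemLp du 2 (volume.restrict (uIcc a b)) := by
    have h3 := h.memLp_deriv.mono_measure hle
    have h4 := h3.smul_measure (c := c⁻¹) (ENNReal.inv_ne_top.2 hc0)
    rwa [smul_smul, ENNReal.inv_mul_cancel hc0 ENNReal.ofReal_ne_top, one_smul] at h4
  have : IsFiniteMeasure (volume.restrict (uIcc a b)) :=
    isFiniteMeasure_restrict.2 isCompact_uIcc.measure_lt_top.ne
  have h5 : IntegrableOn du (uIcc a b) := h2.integrable (by norm_num)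
  exact h5.intervalIntegrable

/-- Uniqueness of the resolvent on `(0, ∞)`. -/
theorem SolvesBesselResolvent.eqOn {lam s : ℝ} (hs : 0 < s) {f u w : ℝ → ℝ}
    (hu : SolvesBesselResolvent lam s f u) (hw : SolvesBesselResolvent lam s f w) :
    EqOn u w (Ioi 0) := by
  obtain ⟨du, hu1, hu2⟩ := hu
  obtain ⟨dw, hw1, hw2⟩ := hw
  have hz : HasEnergyDeriv lam (fun x => u x - w x) (fun x => du x - dw x) := by
    refine ⟨hu1.memLp.sub hw1.memLp, hu1.memLp_deriv.sub hw1.memLp_deriv, fun a b ha hb => ?_⟩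
    rw [intervalIntegral.integral_sub (hu1.intervalIntegrable ha hb)
      (hw1.intervalIntegrable ha hb), ← hu1.sub_eq a b ha hb, ← hw1.sub_eq a b ha hb]
    ring
  have hdiff := congrArg₂ (· - ·) (hu2 _ _ hz) (hw2 _ _ hz)
  have i1 := hu1.memLp_deriv.integrable_mul hz.memLp_deriv
  have i2 := hw1.memLp_deriv.integrable_mul hz.memLp_deriv
  have i3 := hu1.memLp.integrable_mul hz.memLp
  have i4 := hw1.memLp.integrable_mul hz.memLp
  have e1 : ∫ x, (du x - dw x) ^ 2 ∂(besselMeasure lam)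
      = (∫ x, du x * (du x - dw x) ∂(besselMeasure lam))
        - ∫ x, dw x * (du x - dw x) ∂(besselMeasure lam) := by
    refine Eq.trans ?_ (integral_sub i1 i2)
    exact integral_congr_ae (ae_of_all _ fun x => by ring)
  have e2 : ∫ x, (u x - w x) ^ 2 ∂(besselMeasure lam)
      = (∫ x, u x * (u x - w x) ∂(besselMeasure lam))
        - ∫ x, w x * (u x - w x) ∂(besselMeasure lam) := by
    refine Eq.trans ?_ (integral_sub i3 i4)
    exact integral_congr_ae (ae_of_all _ fun x => by ring)
  have p1 : 0 ≤ ∫ x, (du x - dw x) ^ 2 ∂(besselMeasure lam) :=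
    integral_nonneg fun x => sq_nonneg _
  have p2 : 0 ≤ ∫ x, (u x - w x) ^ 2 ∂(besselMeasure lam) :=
    integral_nonneg fun x => sq_nonneg _
  have hzero : ∫ x, (u x - w x) ^ 2 ∂(besselMeasure lam) = 0 := by
    nlinarith [hdiff, e1, e2, p1, p2]
  have hae := (integral_eq_zero_iff_of_nonneg (fun x => sq_nonneg _) hz.memLp.integrable_sq).1 hzero
  have hae2 : ∀ᵐ x ∂(volume.restrict (Ioi (0 : ℝ))), u x = w x := by
    rw [besselMeasure, Filter.EventuallyEq, ae_withDensity_iff (by fun_prop)] at hae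
    filter_upwards [hae, ae_restrict_mem measurableSet_Ioi] with x hx hx0
    have h6 := hx (by simpa using Real.rpow_pos_of_pos hx0 _)
    have h7 : u x - w x = 0 := by simpa using h6
    linarith
  have hcont : ∀ z dz : ℝ → ℝ, HasEnergyDeriv lam z dz → ContinuousOn z (Ioi 0) := by
    intro z dz hz x hx
    have hx0 : (0 : ℝ) < x := hx
    have hx2 : x / 2 < x := by linarith
    have hi : IntegrableOn dz (uIcc (x / 2) (x + 1)) := by
      have := hz.intervalIntegrable (a := x / 2) (b := x + 1) (by linarith) (by linarith)
      exact (intervalIntegrable_iff' (by simp)).1 this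
    have hc := intervalIntegral.continuousOn_primitive_interval hi
    have hc2 : ContinuousAt (fun y => ∫ t in (x / 2)..y, dz t) x := by
      refine hc.continuousAt ?_
      rw [uIcc_of_le (by linarith)]
      exact Icc_mem_nhds hx2 (by linarith)
    have hc3 : ContinuousAt (fun y => z (x / 2) + ∫ t in (x / 2)..y, dz t) x :=
      continuousAt_const.add hc2
    refine (hc3.congr ?_).continuousWithinAt
    filter_upwards [Ioi_mem_nhds hx0] with y hy
    rw [← hz.sub_eq (x / 2) y (by linarith) hy]
    ring
  exact Measure.eqOn_open_of_ae_eq hae2 isOpen_Ioi (hcont _ _ hu1) (hcont _ _ hw1)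

end

/-!
A single test function refutes the weak type bound. Let `f ≥ 0` be a continuous bump supported in
`[1, 2]` and `b = log (x ^ (2 λ))`. To the right of the support the kernel of `R` has constant sign
and size `x ^ (-(2 λ + 1))`, so that `|[b, R] f(x)|` is at least a constant times
`(log x - log 2) x ^ (-(2 λ + 1))` for `x > 2` (`exists_le_abs_besselCommutator_log_bump`). As
`μ (0, x)` is a multiple of `x ^ (2 λ + 1)`, this is not in weak `L¹(μ)`: on `(a, 2 a)` the logarithm
contributes an unbounded factor (`not_isBesselWeakTypeOne_of_le`).

The kernel is obtained from an explicit resolvent. The Laplace transforms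
`φ(x) = ∫_1^∞ e^{-x t} (t² - 1) ^ (λ - 1) dt` and `ψ(x) = ∫_{-1}^1 e^{x t} (1 - t²) ^ (λ - 1) dt`
solve `u'' + (2 λ / x) u' = u`; they are multiples of `x ^ (1/2 - λ)` times the modified Bessel
functions of order `λ - 1/2`, and both integrals converge for every `λ > 0`. Variation of constants
gives a classical solution of `(k² + Δ) u = f`, and the integration by parts of
`solvesBesselResolvent_of_hasDerivAt` shows that it is the weak one
(`besselResolvent_eq_besselGreen`). For `x > 2` it equals
`k ^ (2 λ - 1) φ(k x) ∫ ψ(k y) f(y) dμ(y)` divided by the Wronskian constant. Balakrishnan's formula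
with `s = k²`, differentiated under the integral sign, then expresses `R f(x)` as a negative multiple
of `∫_0^∞ s ^ (λ - 1/2) |φ'(√s x)| ∫ ψ(√s y) f(y) dμ(y) ds` (`besselRiesz_eq_of_two_lt`). Everything
needed is read off from this formula: the sign, and with `ψ ≥ ψ(0)` and the substitution
`s ↦ s / x²` the lower bound (`exists_le_rieszIntegral`).

That `b` has bounded mean oscillation follows from the explicit primitive of
`x ^ (2 λ) log (q / x)`, which shows that on every interval `(p, q)` the mean distance of `b` from
`b(q)` is at most `2 λ / (2 λ + 1)` (`memBesselBMO_log_rpow`).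
-/

noncomputable section

open Filter Topology ProbabilityTheory

/-! ### Modified Bessel functions as Laplace transforms -/

/-- The measure `(t² - 1) ^ (λ - 1) dt` on `(1, ∞)`. Its Laplace transform is, up to a power and a
constant, the Macdonald function of order `λ - 1/2`. -/
def decayWeight (lam : ℝ) : Measure ℝ :=
  (volume.restrict (Ioi 1)).withDensity fun t => ENNReal.ofReal ((t ^ 2 - 1) ^ (lam - 1))

/-- The measure `(1 - t²) ^ (λ - 1) dt` on `(-1, 1)`. Its Laplace transform is, up to a power and a
constant, the modified Bessel function of the first kind of order `λ - 1/2`. -/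
def growthWeight (lam : ℝ) : Measure ℝ :=
  (volume.restrict (Ioo (-1) 1)).withDensity fun t => ENNReal.ofReal ((1 - t ^ 2) ^ (lam - 1))

/-- `∫_1^∞ t ^ n e^{-x t} (t² - 1) ^ (λ - 1) dt`. For `n = 0` this is the solution of
`φ'' + (2 λ / x) φ' = φ` on `(0, ∞)` that decays at infinity, and, up to sign, the other values of
`n` give its derivatives. -/
def besselDecay (lam : ℝ) (n : ℕ) (x : ℝ) : ℝ :=
  ∫ t, t ^ n * Real.exp (-x * t) ∂(decayWeight lam)

/-- `∫_{-1}^1 t ^ n e^{x t} (1 - t²) ^ (λ - 1) dt`. For `n = 0` this is the solution of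
`ψ'' + (2 λ / x) ψ' = ψ` on `(0, ∞)` that is regular at the origin, and the other values of `n` give
its derivatives. -/
def besselGrowth (lam : ℝ) (n : ℕ) (x : ℝ) : ℝ :=
  ∫ t, t ^ n * Real.exp (x * t) ∂(growthWeight lam)

theorem integrable_decayWeight_iff {lam : ℝ} {g : ℝ → ℝ} :
    Integrable g (decayWeight lam) ↔
      IntegrableOn (fun t => g t * (t ^ 2 - 1) ^ (lam - 1)) (Ioi 1) := by
  rw [decayWeight, integrable_withDensity_iff (by fun_prop) (by simp), IntegrableOn]
  refine integrable_congr ?_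
  filter_upwards [ae_restrict_mem measurableSet_Ioi] with t (ht : 1 < t)
  rw [ENNReal.toReal_ofReal (Real.rpow_nonneg (by nlinarith) _)]

theorem integral_decayWeight {lam : ℝ} (g : ℝ → ℝ) :
    ∫ t, g t ∂(decayWeight lam) = ∫ t in Ioi 1, g t * (t ^ 2 - 1) ^ (lam - 1) := by
  rw [decayWeight, integral_withDensity_eq_integral_toReal_smul (by fun_prop) (by simp)]
  refine integral_congr_ae ?_
  filter_upwards [ae_restrict_mem measurableSet_Ioi] with t (ht : 1 < t)
  rw [ENNReal.toReal_ofReal (Real.rpow_nonneg (by nlinarith) _), smul_eq_mul, mul_comm]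

theorem integrable_growthWeight_iff {lam : ℝ} {g : ℝ → ℝ} :
    Integrable g (growthWeight lam) ↔
      IntegrableOn (fun t => g t * (1 - t ^ 2) ^ (lam - 1)) (Ioo (-1) 1) := by
  rw [growthWeight, integrable_withDensity_iff (by fun_prop) (by simp), IntegrableOn]
  refine integrable_congr ?_
  filter_upwards [ae_restrict_mem measurableSet_Ioo] with t ht
  rw [ENNReal.toReal_ofReal (Real.rpow_nonneg (by nlinarith [ht.1, ht.2]) _)]

theorem integral_growthWeight {lam : ℝ} (g : ℝ → ℝ) :
    ∫ t, g t ∂(growthWeight lam) = ∫ t in Ioo (-1) 1, g t * (1 - t ^ 2) ^ (lam - 1) := by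
  rw [growthWeight, integral_withDensity_eq_integral_toReal_smul (by fun_prop) (by simp)]
  refine integral_congr_ae ?_
  filter_upwards [ae_restrict_mem measurableSet_Ioo] with t ht
  rw [ENNReal.toReal_ofReal (Real.rpow_nonneg (by nlinarith [ht.1, ht.2]) _), smul_eq_mul,
    mul_comm]

theorem ae_decayWeight_one_lt (lam : ℝ) : ∀ᵐ t ∂(decayWeight lam), 1 < t :=
  (withDensity_absolutelyContinuous _ _).ae_le (ae_restrict_mem measurableSet_Ioi)

theorem ae_growthWeight_mem (lam : ℝ) : ∀ᵐ t ∂(growthWeight lam), t ∈ Ioo (-1 : ℝ) 1 :=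
  (withDensity_absolutelyContinuous _ _).ae_le (ae_restrict_mem measurableSet_Ioo)

theorem integrableOn_sub_one_rpow {lam : ℝ} (hlam : 0 < lam) (b : ℝ) :
    IntegrableOn (fun t : ℝ => (t - 1) ^ (lam - 1)) (Icc 1 b) := by
  rcases lt_or_ge b 1 with hb | hb
  · simp [Icc_eq_empty_of_lt hb]
  have h := (intervalIntegral.intervalIntegrable_rpow' (a := 0) (b := b - 1) (r := lam - 1)
    (by linarith)).comp_sub_right 1
  simp only [zero_add, sub_add_cancel] at h
  rwa [intervalIntegrable_iff_integrableOn_Icc_of_le hb] at h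

/-- The weight behaves like `(t - 1) ^ (λ - 1)` at `1` and like `t ^ (2 λ - 2)` at infinity. -/
theorem integrable_rpow_neg_decayWeight {lam a : ℝ} (hlam : 0 < lam) (ha : 2 * lam - 1 < a) :
    Integrable (fun t => t ^ (-a)) (decayWeight lam) := by
  rw [integrable_decayWeight_iff, ← Ioc_union_Ioi_eq_Ioi (one_le_two)]
  refine IntegrableOn.union ?_ ?_
  · have hc : ContinuousOn (fun t : ℝ => t ^ (-a) * (t + 1) ^ (lam - 1)) (Icc 1 2) := by
      intro t ht
      have h0 : t ≠ 0 := by linarith [ht.1]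
      have h1 : t + 1 ≠ 0 := by linarith [ht.1]
      exact ((Real.continuousAt_rpow_const _ _ (Or.inl h0)).mul
        ((continuousAt_id.add continuousAt_const).rpow_const (Or.inl h1))).continuousWithinAt
    refine ((IntegrableOn.continuousOn_mul hc (integrableOn_sub_one_rpow hlam 2) isCompact_Icc).mono_set
      Ioc_subset_Icc_self).congr_fun (fun t ht => ?_) measurableSet_Ioc
    have h1 : t ^ 2 - 1 = (t + 1) * (t - 1) := by ring
    simp only
    rw [h1, Real.mul_rpow (by linarith [ht.1]) (by linarith [ht.1])]
    ring
  · have hi := (integrableOn_Ioi_rpow_of_lt (a := -a + 2 * (lam - 1)) (by linarith)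
      (two_pos)).const_mul (max 1 ((3 / 4 : ℝ) ^ (lam - 1)))
    refine hi.mono' (by fun_prop) ?_
    filter_upwards [ae_restrict_mem measurableSet_Ioi] with t (ht : 2 < t)
    have ht0 : 0 < t := by linarith
    have h1 : t ^ 2 - 1 = t ^ (2 : ℝ) * (1 - 1 / t ^ 2) := by
      rw [Real.rpow_two]; field_simp
    have h2 : 3 / 4 ≤ 1 - 1 / t ^ 2 := by
      have : 1 / t ^ 2 ≤ 1 / 4 := by
        apply one_div_le_one_div_of_le <;> nlinarith
      linarith
    have h3 : 1 - 1 / t ^ 2 ≤ 1 := by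
      have : 0 ≤ 1 / t ^ 2 := by positivity
      linarith
    have h4 : (1 - 1 / t ^ 2) ^ (lam - 1) ≤ max 1 ((3 / 4 : ℝ) ^ (lam - 1)) := by
      rcases le_total 0 (lam - 1) with h | h
      · exact (Real.rpow_le_one (by linarith) h3 h).trans (le_max_left _ _)
      · exact (Real.rpow_le_rpow_of_nonpos (by norm_num) h2 h).trans (le_max_right _ _)
    have h5 : 0 ≤ (1 - 1 / t ^ 2) ^ (lam - 1) := Real.rpow_nonneg (by linarith) _
    rw [Real.norm_eq_abs, h1, Real.mul_rpow (by positivity) (by linarith), ← Real.rpow_mul ht0.le,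
      abs_of_nonneg (by positivity), ← mul_assoc, ← Real.rpow_add ht0, mul_comm]
    exact mul_le_mul_of_nonneg_right h4 (by positivity)

theorem exp_neg_le_rpow_neg {u a : ℝ} (hu : 0 < u) (ha : 0 ≤ a) :
    Real.exp (-u) ≤ a ^ a * u ^ (-a) := by
  have h := rpow_abs_le_mul_max_exp_of_pos u ha one_pos
  rw [abs_of_pos hu, div_one, one_mul, neg_one_mul,
    max_eq_left (Real.exp_le_exp.2 (by linarith))] at h
  rw [Real.exp_neg, Real.rpow_neg hu.le, ← div_eq_mul_inv, le_div_iff₀ (by positivity),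
    ← div_eq_inv_mul, div_le_iff₀ (Real.exp_pos _)]
  exact h

theorem integrable_exp_decayWeight {lam x : ℝ} (hlam : 0 < lam) (hx : x < 0) :
    Integrable (fun t => Real.exp (x * t)) (decayWeight lam) := by
  have hi := (integrable_rpow_neg_decayWeight (a := 2 * lam) hlam (by linarith)).const_mul
    ((2 * lam) ^ (2 * lam) * (-x) ^ (-(2 * lam)))
  refine hi.mono' (by fun_prop) ?_
  filter_upwards [ae_decayWeight_one_lt lam] with t ht
  have h := exp_neg_le_rpow_neg (u := -x * t) (a := 2 * lam) (by nlinarith) (by linarith)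
  rw [Real.mul_rpow (x := -x) (by linarith) (by linarith), ← mul_assoc] at h
  rw [Real.norm_eq_abs, abs_of_pos (Real.exp_pos _), show x * t = -(-x * t) by ring]
  exact h

theorem mem_interior_integrableExpSet_decayWeight {lam x : ℝ} (hlam : 0 < lam) (hx : 0 < x) :
    -x ∈ interior (integrableExpSet id (decayWeight lam)) :=
  interior_maximal (t := Iio (0 : ℝ)) (fun _ hy => integrable_exp_decayWeight hlam hy) isOpen_Iio
    (mem_Iio.2 (neg_lt_zero.2 hx))

theorem integrable_besselDecay {lam x : ℝ} (hlam : 0 < lam) (hx : 0 < x) (n : ℕ) :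
    Integrable (fun t => t ^ n * Real.exp (-x * t)) (decayWeight lam) :=
  integrable_pow_mul_exp_of_mem_interior_integrableExpSet (X := id)
    (mem_interior_integrableExpSet_decayWeight hlam hx) n

theorem hasDerivAt_besselDecay {lam x : ℝ} (hlam : 0 < lam) (hx : 0 < x) (n : ℕ) :
    HasDerivAt (besselDecay lam n) (-besselDecay lam (n + 1) x) x := by
  have h := hasDerivAt_integral_pow_mul_exp_real (X := id)
    (mem_interior_integrableExpSet_decayWeight hlam hx) n
  have h2 := h.comp x (hasDerivAt_neg x)
  simp only [mul_neg, mul_one] at h2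
  exact h2

theorem integrable_growthWeight_of_continuous {lam : ℝ} (hlam : 0 < lam) {g : ℝ → ℝ}
    (hg : Continuous g) : Integrable g (growthWeight lam) := by
  have h1 : Ioo (-1 : ℝ) 1 ⊆ Icc (-1) 0 ∪ Icc 0 1 := fun t ht => by
    rcases le_total t 0 with h | h
    · exact Or.inl ⟨ht.1.le, h⟩
    · exact Or.inr ⟨h, ht.2.le⟩
  have hpos : ∀ t : ℝ, t ∈ Icc (0 : ℝ) 1 → 1 + t ≠ 0 := fun t ht => by linarith [ht.1]
  -- The singularity at each end point is an integrable power of the distance.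
  have key : ∀ h : ℝ → ℝ, Continuous h →
      IntegrableOn (fun t => h t * (1 - t ^ 2) ^ (lam - 1)) (Icc 0 1) := by
    intro h hh
    have h3 := (intervalIntegral.intervalIntegrable_rpow' (a := 0) (b := 1) (r := lam - 1)
      (by linarith)).comp_sub_left 1
    simp only [sub_zero, sub_self] at h3
    have h4 := h3.symm
    rw [intervalIntegrable_iff_integrableOn_Icc_of_le zero_le_one] at h4
    have hc : ContinuousOn (fun t : ℝ => h t * (1 + t) ^ (lam - 1)) (Icc 0 1) := fun t ht =>
      (hh.continuousAt.mul ((continuousAt_const.add continuousAt_id).rpow_const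
        (Or.inl (hpos t ht)))).continuousWithinAt
    refine (IntegrableOn.continuousOn_mul hc h4 isCompact_Icc).congr_fun (fun t ht => ?_) measurableSet_Icc
    simp only
    rw [show 1 - t ^ 2 = (1 + t) * (1 - t) by ring,
      Real.mul_rpow (by linarith [ht.1]) (by linarith [ht.2])]
    ring
  rw [integrable_growthWeight_iff]
  refine IntegrableOn.mono_set (IntegrableOn.union ?_ (key g hg)) h1
  have h5 := key (fun t => g (-t)) (hg.comp continuous_neg)
  rw [← intervalIntegrable_iff_integrableOn_Icc_of_le zero_le_one,
    IntervalIntegrable.iff_comp_neg] at h5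
  have h6 := h5.symm
  simp only [neg_neg, neg_sq, neg_zero] at h6
  rwa [intervalIntegrable_iff_integrableOn_Icc_of_le (by norm_num)] at h6

theorem hasDerivAt_besselGrowth {lam : ℝ} (hlam : 0 < lam) (x : ℝ) (n : ℕ) :
    HasDerivAt (besselGrowth lam n) (besselGrowth lam (n + 1) x) x :=
  hasDerivAt_integral_pow_mul_exp_real (X := id)
    (interior_maximal (t := univ)
      (fun y _ => integrable_growthWeight_of_continuous hlam (by fun_prop)) isOpen_univ
      (mem_univ x)) n

theorem integrable_besselGrowth {lam : ℝ} (hlam : 0 < lam) (x : ℝ) (n : ℕ) :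
    Integrable (fun t => t ^ n * Real.exp (x * t)) (growthWeight lam) :=
  integrable_growthWeight_of_continuous hlam (by fun_prop)

/-- The differential equation `φ'' + (2 λ / x) φ' = φ` for `φ = besselDecay lam 0`. -/
theorem besselDecay_ode {lam x : ℝ} (hlam : 0 < lam) (hx : 0 < x) :
    x * (besselDecay lam 2 x - besselDecay lam 0 x) = 2 * lam * besselDecay lam 1 x := by
  have i0 := integrable_besselDecay hlam hx 0
  have i1 := integrable_besselDecay hlam hx 1
  have i2 := integrable_besselDecay hlam hx 2
  have i3 : Integrable (fun t => x * (t ^ 2 * Real.exp (-x * t) - t ^ 0 * Real.exp (-x * t)))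
      (decayWeight lam) := (i2.sub i0).const_mul x
  have hi := (i1.const_mul (2 * lam)).sub i3
  have hi' := integrable_decayWeight_iff.1 hi
  -- The identity is `∫_1^∞ (e^{-x t} (t² - 1) ^ λ)' dt = 0`.
  have hd : ∀ t ∈ Ioi (1 : ℝ), HasDerivAt (fun t => Real.exp (-x * t) * (t ^ 2 - 1) ^ lam)
      ((2 * lam * (t ^ 1 * Real.exp (-x * t))
        - x * (t ^ 2 * Real.exp (-x * t) - t ^ 0 * Real.exp (-x * t)))
        * (t ^ 2 - 1) ^ (lam - 1)) t := by
    intro t (ht : 1 < t)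
    have hpos : 0 < t ^ 2 - 1 := by nlinarith
    have h1 : HasDerivAt (fun t => Real.exp (-x * t)) (Real.exp (-x * t) * (-x * 1)) t :=
      ((hasDerivAt_id t).const_mul (-x)).exp
    have h2 : HasDerivAt (fun t : ℝ => (t ^ 2 - 1) ^ lam)
        ((2 * t) * lam * (t ^ 2 - 1) ^ (lam - 1)) t := by
      have := ((hasDerivAt_pow 2 t).sub_const 1).rpow_const (p := lam) (Or.inl hpos.ne')
      simpa using this
    refine (h1.mul h2).congr_deriv ?_
    rw [show (t ^ 2 - 1) ^ lam = (t ^ 2 - 1) * (t ^ 2 - 1) ^ (lam - 1) by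
      rw [Real.rpow_sub_one hpos.ne']; field_simp]
    ring
  have hlim : Tendsto (fun t => Real.exp (-x * t) * (t ^ 2 - 1) ^ lam) atTop (𝓝 0) := by
    refine squeeze_zero' ?_ ?_ (tendsto_rpow_mul_exp_neg_mul_atTop_nhds_zero (2 * lam) x hx)
    · filter_upwards [eventually_gt_atTop 1] with t ht
      exact mul_nonneg (Real.exp_pos _).le (Real.rpow_nonneg (by nlinarith) _)
    · filter_upwards [eventually_gt_atTop 1] with t ht
      rw [mul_comm, Real.rpow_mul (by linarith), Real.rpow_two]
      gcongr
      · nlinarith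
      · linarith
  have hcont : ContinuousWithinAt (fun t : ℝ => Real.exp (-x * t) * (t ^ 2 - 1) ^ lam) (Ici 1) 1 :=
    (Continuous.mul (by fun_prop) ((by fun_prop : Continuous fun t : ℝ => t ^ 2 - 1).rpow_const
      fun _ => Or.inr hlam.le)).continuousWithinAt
  have h := integral_Ioi_of_hasDerivAt_of_tendsto hcont hd hi' hlim
  have h2 := integral_decayWeight (lam := lam) (fun t => 2 * lam * (t ^ 1 * Real.exp (-x * t))
        - x * (t ^ 2 * Real.exp (-x * t) - t ^ 0 * Real.exp (-x * t)))
  rw [h, integral_sub (i1.const_mul _) i3, integral_const_mul,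
    integral_const_mul, integral_sub i2 i0] at h2
  simp only [one_pow, sub_self, Real.zero_rpow hlam.ne', mul_zero] at h2
  simp only [besselDecay]
  linarith

/-- The differential equation `ψ'' + (2 λ / x) ψ' = ψ` for `ψ = besselGrowth lam 0`. -/
theorem besselGrowth_ode {lam : ℝ} (hlam : 0 < lam) (x : ℝ) :
    x * (besselGrowth lam 0 x - besselGrowth lam 2 x) = 2 * lam * besselGrowth lam 1 x := by
  have i0 := integrable_besselGrowth hlam x 0
  have i1 := integrable_besselGrowth hlam x 1
  have i2 := integrable_besselGrowth hlam x 2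
  have i3 : Integrable (fun t => x * (t ^ 0 * Real.exp (x * t) - t ^ 2 * Real.exp (x * t)))
      (growthWeight lam) := (i0.sub i2).const_mul x
  have hi := i3.sub (i1.const_mul (2 * lam))
  have hi' := integrable_growthWeight_iff.1 hi
  have hd : ∀ t ∈ Ioo (-1 : ℝ) 1, HasDerivAt (fun t => Real.exp (x * t) * (1 - t ^ 2) ^ lam)
      ((x * (t ^ 0 * Real.exp (x * t) - t ^ 2 * Real.exp (x * t))
        - 2 * lam * (t ^ 1 * Real.exp (x * t))) * (1 - t ^ 2) ^ (lam - 1)) t := by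
    intro t ht
    have hpos : 0 < 1 - t ^ 2 := by nlinarith [ht.1, ht.2]
    have h1 : HasDerivAt (fun t => Real.exp (x * t)) (Real.exp (x * t) * (x * 1)) t :=
      ((hasDerivAt_id t).const_mul x).exp
    have h2 : HasDerivAt (fun t : ℝ => (1 - t ^ 2) ^ lam)
        (-(2 * t) * lam * (1 - t ^ 2) ^ (lam - 1)) t := by
      have := ((hasDerivAt_pow 2 t).const_sub 1).rpow_const (p := lam) (Or.inl hpos.ne')
      simpa using this
    refine (h1.mul h2).congr_deriv ?_
    rw [show (1 - t ^ 2) ^ lam = (1 - t ^ 2) * (1 - t ^ 2) ^ (lam - 1) by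
      rw [Real.rpow_sub_one hpos.ne']; field_simp]
    ring
  have hcont : ContinuousOn (fun t : ℝ => Real.exp (x * t) * (1 - t ^ 2) ^ lam) (Icc (-1) 1) :=
    (Continuous.mul (by fun_prop) ((by fun_prop : Continuous fun t : ℝ => 1 - t ^ 2).rpow_const
      fun _ => Or.inr hlam.le)).continuousOn
  have h := intervalIntegral.integral_eq_sub_of_hasDerivAt_of_le (by norm_num) hcont hd
    ((intervalIntegrable_iff_integrableOn_Ioo_of_le (by norm_num)).2 hi')
  rw [intervalIntegral.integral_of_le (by norm_num), integral_Ioc_eq_integral_Ioo] at h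
  have h2 := integral_growthWeight (lam := lam)
    (fun t => x * (t ^ 0 * Real.exp (x * t) - t ^ 2 * Real.exp (x * t))
        - 2 * lam * (t ^ 1 * Real.exp (x * t)))
  rw [h, integral_sub i3 (i1.const_mul _), integral_const_mul,
    integral_const_mul, integral_sub i0 i2] at h2
  norm_num [Real.zero_rpow hlam.ne'] at h2
  simp only [besselGrowth]
  norm_num
  linarith

/-! ### Bounds and the Wronskian -/

theorem besselDecay_pos {lam x : ℝ} (hlam : 0 < lam) (hx : 0 < x) (n : ℕ) :
    0 < besselDecay lam n x := by
  have hi := integrable_decayWeight_iff.1 (integrable_besselDecay hlam hx n)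
  have hp : ∀ t ∈ Ioi (1 : ℝ), 0 < t ^ n * Real.exp (-x * t) * (t ^ 2 - 1) ^ (lam - 1) := by
    intro t (ht : 1 < t)
    have h1 : 0 < (t ^ 2 - 1) ^ (lam - 1) := Real.rpow_pos_of_pos (by nlinarith) _
    positivity
  rw [besselDecay, integral_decayWeight, setIntegral_pos_iff_support_of_nonneg_ae
    ((ae_restrict_mem measurableSet_Ioi).mono fun t ht => (hp t ht).le) hi]
  exact lt_of_lt_of_le (b := volume (Ioi (1 : ℝ))) (by simp)
    (measure_mono fun t ht => ⟨(hp t ht).ne', ht⟩)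

/-- Exponential decay, from `t > 1` in the domain of integration. -/
theorem besselDecay_add_le {lam x h : ℝ} (hlam : 0 < lam) (hx : 0 < x) (hh : 0 ≤ h) (n : ℕ) :
    besselDecay lam n (x + h) ≤ Real.exp (-h) * besselDecay lam n x := by
  rw [besselDecay, besselDecay, ← integral_const_mul]
  refine integral_mono_ae (integrable_besselDecay hlam (by linarith) n)
    ((integrable_besselDecay hlam hx n).const_mul _) ?_
  filter_upwards [ae_decayWeight_one_lt lam] with t ht
  have h1 : Real.exp (-(x + h) * t) ≤ Real.exp (-h) * Real.exp (-x * t) := by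
    rw [← Real.exp_add]
    exact Real.exp_le_exp.2 (by nlinarith)
  calc t ^ n * Real.exp (-(x + h) * t) ≤ t ^ n * (Real.exp (-h) * Real.exp (-x * t)) := by gcongr
    _ = Real.exp (-h) * (t ^ n * Real.exp (-x * t)) := by ring

theorem besselDecay_anti {lam x y : ℝ} (hlam : 0 < lam) (hx : 0 < x) (hxy : x ≤ y) (n : ℕ) :
    besselDecay lam n y ≤ besselDecay lam n x := by
  have h := besselDecay_add_le (h := y - x) hlam hx (by linarith) n
  rw [add_sub_cancel] at h
  refine h.trans ?_
  have h1 : Real.exp (-(y - x)) ≤ 1 := Real.exp_le_one_iff.2 (by linarith)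
  nlinarith [besselDecay_pos hlam hx n]

/-- The bound `φ(x) ≤ C x ^ (-a)` for any `a > 2 λ - 1`, `a ≥ 0`, whatever the size of `λ`. It
stands in for the asymptotics of `φ` at the origin, which are different for `λ < 1/2`, `λ = 1/2` and
`λ > 1/2`. -/
theorem besselDecay_zero_le_rpow {lam a : ℝ} (hlam : 0 < lam) (ha : 2 * lam - 1 < a)
    (ha0 : 0 ≤ a) : ∃ C : ℝ, 0 ≤ C ∧ ∀ x : ℝ, 0 < x → besselDecay lam 0 x ≤ C * x ^ (-a) := by
  have hi := integrable_rpow_neg_decayWeight hlam ha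
  refine ⟨a ^ a * ∫ t, t ^ (-a) ∂(decayWeight lam), mul_nonneg (by positivity)
    (integral_nonneg_of_ae ?_), fun x hx => ?_⟩
  · filter_upwards [ae_decayWeight_one_lt lam] with t ht
    exact Real.rpow_nonneg (by linarith) _
  · rw [mul_right_comm, ← integral_const_mul, besselDecay]
    refine integral_mono_ae (integrable_besselDecay hlam hx 0) (hi.const_mul _) ?_
    filter_upwards [ae_decayWeight_one_lt lam] with t ht
    have h := exp_neg_le_rpow_neg (u := x * t) (by nlinarith) ha0
    rw [Real.mul_rpow hx.le (by linarith), ← mul_assoc] at h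
    simpa using h

theorem besselGrowth_zero_zero_pos {lam : ℝ} (hlam : 0 < lam) : 0 < besselGrowth lam 0 0 := by
  have hi := integrable_growthWeight_iff.1 (integrable_besselGrowth hlam 0 0)
  have hp : ∀ t ∈ Ioo (-1 : ℝ) 1, 0 < t ^ 0 * Real.exp (0 * t) * (1 - t ^ 2) ^ (lam - 1) := by
    intro t ht
    have h1 : 0 < (1 - t ^ 2) ^ (lam - 1) := Real.rpow_pos_of_pos (by nlinarith [ht.1, ht.2]) _
    positivity
  rw [besselGrowth, integral_growthWeight, setIntegral_pos_iff_support_of_nonneg_ae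
    ((ae_restrict_mem measurableSet_Ioo).mono fun t ht => (hp t ht).le) hi]
  exact lt_of_lt_of_le (b := volume (Ioo (-1 : ℝ) 1)) (by simp)
    (measure_mono fun t ht => ⟨(hp t ht).ne', ht⟩)

/-- `ψ` attains its minimum at the origin, because `e^{x t} ≥ 1 + x t` and the weight is even. -/
theorem besselGrowth_zero_le {lam : ℝ} (hlam : 0 < lam) (x : ℝ) :
    besselGrowth lam 0 0 ≤ besselGrowth lam 0 x := by
  have h1 : besselGrowth lam 1 0 = 0 := by
    have h := besselGrowth_ode hlam 0
    rw [zero_mul] at h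
    simpa [hlam.ne'] using h.symm
  have i0 := integrable_besselGrowth hlam 0 0
  have i1 := (integrable_besselGrowth hlam 0 1).const_mul x
  have h2 : besselGrowth lam 0 0 = ∫ t, (t ^ 0 * Real.exp (0 * t) + x * (t ^ 1 * Real.exp (0 * t)))
      ∂(growthWeight lam) := by
    rw [integral_add i0 i1, integral_const_mul]
    change _ = besselGrowth lam 0 0 + x * besselGrowth lam 1 0
    rw [h1]
    ring
  rw [h2]
  refine integral_mono (i0.add i1) (integrable_besselGrowth hlam x 0) fun t => ?_
  simp only [pow_zero, zero_mul, Real.exp_zero, pow_one, one_mul, mul_one]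
  linarith [Real.add_one_le_exp (x * t)]

theorem besselGrowth_zero_pos {lam : ℝ} (hlam : 0 < lam) (x : ℝ) : 0 < besselGrowth lam 0 x :=
  (besselGrowth_zero_zero_pos hlam).trans_le (besselGrowth_zero_le hlam x)

theorem besselGrowth_zero_le_exp {lam x : ℝ} (hlam : 0 < lam) (hx : 0 ≤ x) :
    besselGrowth lam 0 x ≤ besselGrowth lam 0 0 * Real.exp x := by
  rw [besselGrowth, besselGrowth, ← integral_mul_const]
  refine integral_mono_ae (integrable_besselGrowth hlam x 0)
    ((integrable_besselGrowth hlam 0 0).mul_const _) ?_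
  filter_upwards [ae_growthWeight_mem lam] with t ht
  simp only [pow_zero, zero_mul, Real.exp_zero, one_mul]
  exact Real.exp_le_exp.2 (by nlinarith [ht.2])

theorem besselGrowth_one_nonneg {lam x : ℝ} (hlam : 0 < lam) (hx : 0 ≤ x) :
    0 ≤ besselGrowth lam 1 x := by
  have h : besselGrowth lam 2 x ≤ besselGrowth lam 0 x := by
    refine integral_mono_ae (integrable_besselGrowth hlam x 2)
      (integrable_besselGrowth hlam x 0) ?_
    filter_upwards [ae_growthWeight_mem lam] with t ht
    have : t ^ 2 ≤ t ^ 0 := by nlinarith [ht.1, ht.2]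
    gcongr
  have h2 := besselGrowth_ode hlam x
  by_contra! hneg
  nlinarith

theorem besselGrowth_one_le {lam x : ℝ} (hlam : 0 < lam) (hx : 0 ≤ x) :
    besselGrowth lam 1 x ≤ x * besselGrowth lam 0 x / (2 * lam) := by
  have h : 0 ≤ besselGrowth lam 2 x := integral_nonneg fun t => by positivity
  rw [le_div_iff₀ (by positivity)]
  nlinarith [besselGrowth_ode hlam x]

/-- The constant value of `x ^ (2 λ) (φ ψ' - φ' ψ)`. -/
def besselWronskian (lam : ℝ) : ℝ :=
  besselDecay lam 0 1 * besselGrowth lam 1 1 + besselDecay lam 1 1 * besselGrowth lam 0 1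

theorem besselWronskian_pos {lam : ℝ} (hlam : 0 < lam) : 0 < besselWronskian lam :=
  add_pos_of_nonneg_of_pos
    (mul_nonneg (besselDecay_pos hlam one_pos 0).le (besselGrowth_one_nonneg hlam zero_le_one))
    (mul_pos (besselDecay_pos hlam one_pos 1) (besselGrowth_zero_pos hlam 1))

theorem rpow_mul_eq_besselWronskian {lam x : ℝ} (hlam : 0 < lam) (hx : 0 < x) :
    x ^ (2 * lam) * (besselDecay lam 0 x * besselGrowth lam 1 x
      + besselDecay lam 1 x * besselGrowth lam 0 x) = besselWronskian lam := by
  have hd : ∀ y ∈ Ioi (0 : ℝ), HasDerivAt (fun x => x ^ (2 * lam) *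
      (besselDecay lam 0 x * besselGrowth lam 1 x
      + besselDecay lam 1 x * besselGrowth lam 0 x)) 0 y := by
    intro y (hy : 0 < y)
    have h1 := (Real.hasDerivAt_rpow_const (p := 2 * lam) (Or.inl hy.ne')).mul
      (((hasDerivAt_besselDecay hlam hy 0).mul (hasDerivAt_besselGrowth hlam y 1)).add
        ((hasDerivAt_besselDecay hlam hy 1).mul (hasDerivAt_besselGrowth hlam y 0)))
    refine h1.congr_deriv ?_
    have e1 := besselDecay_ode hlam hy
    have e2 := besselGrowth_ode hlam y
    have e3 : y ^ (2 * lam) = y ^ (2 * lam - 1) * y := by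
      rw [Real.rpow_sub_one hy.ne']; field_simp
    simp only [Pi.mul_apply, zero_add, Nat.reduceAdd, e3, Pi.add_apply]
    linear_combination (-besselGrowth lam 0 y * y ^ (2 * lam - 1)) * e1
      + (-besselDecay lam 0 y * y ^ (2 * lam - 1)) * e2
  have h := isOpen_Ioi.is_const_of_deriv_eq_zero isPreconnected_Ioi
    (fun y hy => (hd y hy).differentiableAt.differentiableWithinAt)
    (fun y hy => (hd y hy).deriv) (mem_Ioi.2 hx) (mem_Ioi.2 one_pos)
  rw [h, Real.one_rpow, one_mul, besselWronskian]

/-- The bound `|φ'(x)| ≤ C x ^ (-2 λ)`, read off from the Wronskian. -/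
theorem besselDecay_one_le {lam x : ℝ} (hlam : 0 < lam) (hx : 0 < x) :
    besselDecay lam 1 x ≤ besselWronskian lam / besselGrowth lam 0 0 * x ^ (-(2 * lam)) := by
  have hw := rpow_mul_eq_besselWronskian hlam hx
  have h1 := mul_nonneg (besselDecay_pos hlam hx 0).le (besselGrowth_one_nonneg hlam hx.le)
  have h2 := besselGrowth_zero_le hlam x
  have h3 := besselDecay_pos hlam hx 1
  have h4 : 0 < x ^ (2 * lam) := Real.rpow_pos_of_pos hx _
  have h5 := besselGrowth_zero_zero_pos hlam
  rw [Real.rpow_neg hx.le, ← div_eq_mul_inv, div_div, le_div_iff₀ (by positivity), ← hw]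
  have h6 : besselDecay lam 1 x * besselGrowth lam 0 0
      ≤ besselDecay lam 0 x * besselGrowth lam 1 x + besselDecay lam 1 x * besselGrowth lam 0 x := by
    nlinarith
  nlinarith

/-! ### The measure `μ` -/

theorem integrable_besselMeasure_iff {lam : ℝ} {g : ℝ → ℝ} :
    Integrable g (besselMeasure lam) ↔ IntegrableOn (fun x => g x * x ^ (2 * lam)) (Ioi 0) := by
  rw [besselMeasure, integrable_withDensity_iff (by fun_prop) (by simp), IntegrableOn]
  refine integrable_congr ?_
  filter_upwards [ae_restrict_mem measurableSet_Ioi] with t (ht : 0 < t)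
  rw [ENNReal.toReal_ofReal (Real.rpow_nonneg ht.le _)]

theorem integral_besselMeasure {lam : ℝ} (g : ℝ → ℝ) :
    ∫ x, g x ∂(besselMeasure lam) = ∫ x in Ioi 0, g x * x ^ (2 * lam) := by
  rw [besselMeasure, integral_withDensity_eq_integral_toReal_smul (by fun_prop) (by simp)]
  refine integral_congr_ae ?_
  filter_upwards [ae_restrict_mem measurableSet_Ioi] with t (ht : 0 < t)
  rw [ENNReal.toReal_ofReal (Real.rpow_nonneg ht.le _), smul_eq_mul, mul_comm]

theorem besselMeasure_restrict_Ioo {lam p q : ℝ} (hp : 0 ≤ p) :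
    (besselMeasure lam).restrict (Ioo p q)
      = (volume.restrict (Ioo p q)).withDensity fun x => ENNReal.ofReal (x ^ (2 * lam)) := by
  rw [besselMeasure, restrict_withDensity measurableSet_Ioo, Measure.restrict_restrict
    measurableSet_Ioo, inter_eq_left.2 fun x hx => mem_Ioi.2 (hp.trans_lt hx.1)]

theorem integrableOn_Ioo_besselMeasure_iff {lam p q : ℝ} (hp : 0 ≤ p) {g : ℝ → ℝ} :
    IntegrableOn g (Ioo p q) (besselMeasure lam) ↔
      IntegrableOn (fun x => g x * x ^ (2 * lam)) (Ioo p q) := by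
  rw [IntegrableOn, besselMeasure_restrict_Ioo hp,
    integrable_withDensity_iff (by fun_prop) (by simp), IntegrableOn]
  refine integrable_congr ?_
  filter_upwards [ae_restrict_mem measurableSet_Ioo] with t ht
  rw [ENNReal.toReal_ofReal (Real.rpow_nonneg (hp.trans ht.1.le) _)]

theorem setIntegral_Ioo_besselMeasure {lam p q : ℝ} (hp : 0 ≤ p) (g : ℝ → ℝ) :
    ∫ x in Ioo p q, g x ∂(besselMeasure lam) = ∫ x in Ioo p q, g x * x ^ (2 * lam) := by
  rw [besselMeasure_restrict_Ioo hp,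
    integral_withDensity_eq_integral_toReal_smul (by fun_prop) (by simp)]
  refine integral_congr_ae ?_
  filter_upwards [ae_restrict_mem measurableSet_Ioo] with t ht
  rw [ENNReal.toReal_ofReal (Real.rpow_nonneg (hp.trans ht.1.le) _), smul_eq_mul, mul_comm]

theorem besselMeasure_Ioo {lam p q : ℝ} (hlam : 0 < lam) (hp : 0 ≤ p) (hpq : p ≤ q) :
    besselMeasure lam (Ioo p q)
      = ENNReal.ofReal ((q ^ (2 * lam + 1) - p ^ (2 * lam + 1)) / (2 * lam + 1)) := by
  have h1 : IntervalIntegrable (fun x : ℝ => x ^ (2 * lam)) volume p q :=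
    intervalIntegral.intervalIntegrable_rpow' (by linarith)
  have h2 : 0 ≤ᵐ[volume.restrict (Ioo p q)] fun x : ℝ => x ^ (2 * lam) := by
    filter_upwards [ae_restrict_mem measurableSet_Ioo] with t ht
    exact Real.rpow_nonneg (hp.trans ht.1.le) _
  rw [← Measure.restrict_apply_univ, besselMeasure_restrict_Ioo hp,
    withDensity_apply _ MeasurableSet.univ, Measure.restrict_univ,
    ← ofReal_integral_eq_lintegral_ofReal
      ((intervalIntegrable_iff_integrableOn_Ioo_of_le hpq).1 h1) h2,
    ← integral_Ioc_eq_integral_Ioo, ← intervalIntegral.integral_of_le hpq,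
    integral_rpow (Or.inl (by linarith))]

/-! ### The logarithm has bounded mean oscillation -/

/-- Bounded oscillation around any constants, in place of the means, suffices. -/
theorem memBesselBMO_of_forall_exists_const {lam K : ℝ} (hlam : 0 < lam) {b : ℝ → ℝ}
    (h : ∀ p q : ℝ, 0 ≤ p → p < q → ∃ c : ℝ,
      IntegrableOn (fun x => b x - c) (Ioo p q) (besselMeasure lam) ∧
      ∫ x in Ioo p q, |b x - c| ∂(besselMeasure lam)
        ≤ K * (besselMeasure lam).real (Ioo p q)) :
    MemBesselBMO lam b := by
  have hfin : ∀ p q : ℝ, 0 ≤ p → p < q →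
      IsFiniteMeasure ((besselMeasure lam).restrict (Ioo p q)) := fun p q hp hpq =>
    isFiniteMeasure_restrict.2 (by rw [besselMeasure_Ioo hlam hp hpq.le]; exact ENNReal.ofReal_ne_top)
  have hint : ∀ p q : ℝ, 0 ≤ p → p < q → IntegrableOn b (Ioo p q) (besselMeasure lam) := by
    intro p q hp hpq
    obtain ⟨c, hc, -⟩ := h p q hp hpq
    have := hfin p q hp hpq
    exact (hc.add (integrable_const c)).congr (ae_of_all _ fun x => by simp)
  refine ⟨hint, 2 * K, fun p q hp hpq => ?_⟩
  obtain ⟨c, hc, hK⟩ := h p q hp hpq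
  have := hfin p q hp hpq
  have hM : 0 < (besselMeasure lam).real (Ioo p q) := by
    rw [measureReal_def, besselMeasure_Ioo hlam hp hpq.le, ENNReal.toReal_ofReal]
    · have := Real.rpow_lt_rpow hp hpq (show 0 < 2 * lam + 1 by linarith)
      exact div_pos (by linarith) (by linarith)
    · have := Real.rpow_lt_rpow hp hpq (show 0 < 2 * lam + 1 by linarith)
      exact div_nonneg (by linarith) (by linarith)
  set M := (besselMeasure lam).real (Ioo p q) with hMdef
  set a := ⨍ y in Ioo p q, b y ∂(besselMeasure lam) with ha
  have hac : |c - a| * M ≤ K * M := by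
    have h1 : ∫ x in Ioo p q, (b x - c) ∂(besselMeasure lam) = M * (a - c) := by
      rw [integral_sub (hint p q hp hpq) (integrable_const c), ha, setAverage_eq, setIntegral_const,
        ← hMdef, smul_eq_mul, smul_eq_mul]
      field_simp
    have h2 := abs_integral_le_integral_abs (f := fun x => b x - c)
      (μ := (besselMeasure lam).restrict (Ioo p q))
    rw [h1, abs_mul, abs_of_pos hM, abs_sub_comm, mul_comm] at h2
    exact h2.trans hK
  rw [setAverage_eq, ← hMdef, smul_eq_mul, inv_mul_le_iff₀ hM]
  have h3 : ∫ x in Ioo p q, |b x - a| ∂(besselMeasure lam)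
      ≤ ∫ x in Ioo p q, (|b x - c| + |c - a|) ∂(besselMeasure lam) := by
    refine integral_mono ((hint p q hp hpq).sub (integrable_const a)).abs
      (hc.abs.add (integrable_const _)) fun x => ?_
    exact abs_sub_le _ _ _
  rw [integral_add hc.abs (integrable_const _), setIntegral_const, ← hMdef, smul_eq_mul] at h3
  linarith

/-- The primitive `x ^ m (log (q / x) + 1 / m) / m` of `x ^ (m - 1) log (q / x)`, where
`m = 2 λ + 1`, shows that on `(p, q)` the mean of `log (q / x)` is at most `1 / m`. -/
theorem integral_log_sub_log_le {lam p q : ℝ} (hlam : 0 < lam) (hp : 0 ≤ p) (hpq : p < q) :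
    IntegrableOn (fun x => (Real.log q - Real.log x) * x ^ (2 * lam)) (Ioo p q) ∧
    ∫ x in Ioo p q, (Real.log q - Real.log x) * x ^ (2 * lam)
      ≤ (1 / (2 * lam + 1)) * ((q ^ (2 * lam + 1) - p ^ (2 * lam + 1)) / (2 * lam + 1)) := by
  set m := 2 * lam + 1 with hm
  have hm0 : 0 < m := by linarith
  set H : ℝ → ℝ := fun x => x ^ m * (Real.log q + 1 / m) / m - x ^ m * Real.log (x ^ m) / m ^ 2
    with hH
  have hcont : ContinuousOn H (Icc p q) := by
    have h1 : Continuous fun x : ℝ => x ^ m := Real.continuous_rpow_const hm0.le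
    exact (((h1.mul continuous_const).div_const _).sub
      ((Real.continuous_mul_log.comp h1).div_const _)).continuousOn
  have hder : ∀ x ∈ Ioo p q, HasDerivAt H ((Real.log q - Real.log x) * x ^ (2 * lam)) x := by
    intro x hx
    have hx0 : 0 < x := hp.trans_lt hx.1
    have h1 := Real.hasDerivAt_rpow_const (x := x) (p := m) (Or.inl hx0.ne')
    have h2 := (Real.hasDerivAt_mul_log (Real.rpow_pos_of_pos hx0 m).ne').comp x h1
    refine (((h1.mul_const _).div_const m).sub (h2.div_const (m ^ 2))).congr_deriv ?_
    rw [Real.log_rpow hx0, show m - 1 = 2 * lam by rw [hm]; ring]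
    field_simp
    ring
  have hnn : ∀ x ∈ Ioo p q, 0 ≤ (Real.log q - Real.log x) * x ^ (2 * lam) := fun x hx =>
    mul_nonneg (sub_nonneg.2 (Real.log_le_log (hp.trans_lt hx.1) hx.2.le))
      (Real.rpow_nonneg (hp.trans hx.1.le) _)
  have hi := intervalIntegral.integrableOn_deriv_of_nonneg hcont hder hnn
  refine ⟨hi.mono_set Ioo_subset_Ioc_self, ?_⟩
  rw [← integral_Ioc_eq_integral_Ioo, ← intervalIntegral.integral_of_le hpq.le,
    intervalIntegral.integral_eq_sub_of_hasDerivAt_of_le hpq.le hcont hder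
      ((intervalIntegrable_iff_integrableOn_Ioc_of_le hpq.le).2 hi)]
  have hq0 : 0 < q := hp.trans_lt hpq
  have h4 : p ^ m * Real.log (p ^ m) ≤ p ^ m * (m * Real.log q) := by
    rcases hp.eq_or_lt with h | h
    · rw [← h, Real.zero_rpow hm0.ne']; simp
    · rw [Real.log_rpow h]
      have := Real.log_le_log h hpq.le
      gcongr
  simp only [hH, Real.log_rpow hq0]
  have h5 : 0 ≤ (p ^ m * (m * Real.log q) - p ^ m * Real.log (p ^ m)) / m ^ 2 :=
    div_nonneg (by linarith) (by positivity)
  have h6 : (1 / m) * ((q ^ m - p ^ m) / m) - (q ^ m * (Real.log q + 1 / m) / m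
      - q ^ m * (m * Real.log q) / m ^ 2 - (p ^ m * (Real.log q + 1 / m) / m
      - p ^ m * Real.log (p ^ m) / m ^ 2))
      = (p ^ m * (m * Real.log q) - p ^ m * Real.log (p ^ m)) / m ^ 2 := by
    field_simp
    ring
  linarith

theorem memBesselBMO_log_rpow {lam : ℝ} (hlam : 0 < lam) :
    MemBesselBMO lam fun x => Real.log (x ^ (2 * lam)) := by
  refine memBesselBMO_of_forall_exists_const (K := 2 * lam * (1 / (2 * lam + 1))) hlam
    fun p q hp hpq => ⟨Real.log (q ^ (2 * lam)), ?_⟩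
  obtain ⟨h1, h2⟩ := integral_log_sub_log_le hlam hp hpq
  have hq0 : 0 < q := hp.trans_lt hpq
  have e1 : ∀ x ∈ Ioo p q, Real.log (x ^ (2 * lam)) - Real.log (q ^ (2 * lam))
      = -(2 * lam * (Real.log q - Real.log x)) := by
    intro x hx
    rw [Real.log_rpow hq0, Real.log_rpow (hp.trans_lt hx.1)]
    ring
  refine ⟨?_, ?_⟩
  · rw [integrableOn_Ioo_besselMeasure_iff hp]
    refine IntegrableOn.congr_fun (Integrable.const_mul h1 (-(2 * lam))) (fun x hx => ?_)
      measurableSet_Ioo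
    simp only [e1 x hx]
    ring
  · rw [setIntegral_Ioo_besselMeasure hp, measureReal_def, besselMeasure_Ioo hlam hp hpq.le,
      ENNReal.toReal_ofReal (div_nonneg (sub_nonneg.2
        (Real.rpow_le_rpow hp hpq.le (by linarith))) (by linarith)), mul_assoc]
    refine le_trans (le_of_eq ?_) (mul_le_mul_of_nonneg_left h2 (by linarith : 0 ≤ 2 * lam))
    rw [← integral_const_mul]
    refine setIntegral_congr_fun measurableSet_Ioo fun x hx => ?_
    have h3 := Real.log_le_log (hp.trans_lt hx.1) hx.2.le
    simp only [e1 x hx]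
    rw [abs_neg, abs_of_nonneg (mul_nonneg (by linarith) (by linarith))]
    ring

/-! ### Integration by parts against the energy space -/

theorem integral_deriv_mul_add_mul_deriv_of_primitive {F F' v v' : ℝ → ℝ} {a b : ℝ}
    (hF' : IntervalIntegrable F' volume a b) (hv' : IntervalIntegrable v' volume a b)
    (hF : ∀ x ∈ uIcc a b, F x - F a = ∫ t in a..x, F' t)
    (hv : ∀ x ∈ uIcc a b, v x - v a = ∫ t in a..x, v' t) :
    ∫ x in a..b, (F' x * v x + F x * v' x) = F b * v b - F a * v a := by
  have hac : ∀ (g' : ℝ → ℝ) (c : ℝ), IntervalIntegrable g' volume a b →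
      AbsolutelyContinuousOnInterval (fun x => c + ∫ t in a..x, g' t) a b := fun g' c hg' =>
    ((LipschitzWith.const c).lipschitzOnWith.absolutelyContinuousOnInterval).add
      (hg'.absolutelyContinuousOnInterval_intervalIntegral left_mem_uIcc)
  have h := (hac F' (F a) hF').integral_deriv_mul_eq_sub (hac v' (v a) hv')
  simp only [← hF b right_mem_uIcc, ← hv b right_mem_uIcc, intervalIntegral.integral_same,
    add_zero, add_sub_cancel] at h
  rw [← h]
  refine intervalIntegral.integral_congr_ae ?_
  filter_upwards [hF'.ae_hasDerivAt_integral, hv'.ae_hasDerivAt_integral] with x h1 h2 hx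
  have hx' := uIoc_subset_uIcc hx
  rw [((h1 hx' a left_mem_uIcc).const_add (F a)).deriv,
    ((h2 hx' a left_mem_uIcc).const_add (v a)).deriv, ← hF x hx', ← hv x hx', add_sub_cancel,
    add_sub_cancel]

/-- Near the origin `x ^ (2 λ) v(x)` stays bounded, as `x ^ (2 λ) ≤ y ^ (2 λ)` for `x ≤ y` gives
`x ^ (2 λ) |v(x) - v(1)| ≤ ∫_0^1 |v'| dμ`. -/
theorem HasEnergyDeriv.exists_rpow_mul_abs_le {lam : ℝ} (hlam : 0 < lam) {v dv : ℝ → ℝ}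
    (h : HasEnergyDeriv lam v dv) :
    ∃ M : ℝ, ∀ x ∈ Ioc (0 : ℝ) 1, x ^ (2 * lam) * |v x| ≤ M := by
  have hfin : IsFiniteMeasure ((besselMeasure lam).restrict (Ioo 0 1)) :=
    isFiniteMeasure_restrict.2 (by
      rw [besselMeasure_Ioo hlam le_rfl zero_le_one]; exact ENNReal.ofReal_ne_top)
  have h1 : IntegrableOn (fun y => |dv y|) (Ioo 0 1) (besselMeasure lam) :=
    ((h.memLp_deriv.restrict (Ioo 0 1)).integrable (by norm_num)).abs
  have h2 := (integrableOn_Ioo_besselMeasure_iff le_rfl).1 h1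
  refine ⟨|v 1| + ∫ y in Ioo 0 1, |dv y| * y ^ (2 * lam), fun x hx => ?_⟩
  have hxp : 0 < x ^ (2 * lam) := Real.rpow_pos_of_pos hx.1 _
  have hx1 : x ^ (2 * lam) ≤ 1 := Real.rpow_le_one hx.1.le hx.2 (by linarith)
  have hi := h.intervalIntegrable hx.1 one_pos
  have h3 : |v 1 - v x| ≤ ∫ y in x..1, |dv y| := by
    rw [h.sub_eq x 1 hx.1 one_pos]
    exact intervalIntegral.abs_integral_le_integral_abs hx.2
  have h4 : x ^ (2 * lam) * ∫ y in x..1, |dv y| ≤ ∫ y in Ioo 0 1, |dv y| * y ^ (2 * lam) := by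
    rw [← intervalIntegral.integral_const_mul, intervalIntegral.integral_of_le hx.2,
      integral_Ioc_eq_integral_Ioo]
    have h5 : Ioo x 1 ⊆ Ioo 0 1 := Ioo_subset_Ioo_left hx.1.le
    refine le_trans (setIntegral_mono_on ?_ (h2.mono_set h5) measurableSet_Ioo fun y hy => ?_)
      (setIntegral_mono_set h2 ?_ (Eventually.of_forall h5))
    · exact (((intervalIntegrable_iff_integrableOn_Ioo_of_le hx.2).1 hi).abs).const_mul _
    · rw [mul_comm]
      have := Real.rpow_le_rpow hx.1.le hy.1.le (by linarith : 0 ≤ 2 * lam)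
      gcongr
    · filter_upwards [ae_restrict_mem measurableSet_Ioo] with y hy
      exact mul_nonneg (abs_nonneg _) (Real.rpow_nonneg hy.1.le _)
  have h6 : |v x| ≤ |v 1| + |v 1 - v x| := by
    have := abs_sub_abs_le_abs_sub (v x) (v 1)
    rw [abs_sub_comm] at this
    linarith
  nlinarith [abs_nonneg (v 1)]

/-- At infinity `v` grows at most linearly, as `|v'| ≤ 1 + |v'|²`. -/
theorem HasEnergyDeriv.exists_abs_le {lam : ℝ} (hlam : 0 < lam) {v dv : ℝ → ℝ}
    (h : HasEnergyDeriv lam v dv) :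
    ∃ M : ℝ, ∀ x : ℝ, 1 ≤ x → |v x| ≤ M + x := by
  have h2 := integrable_besselMeasure_iff.1 h.memLp_deriv.integrable_sq
  refine ⟨|v 1| + ∫ y in Ioi 0, dv y ^ 2 * y ^ (2 * lam), fun x hx => ?_⟩
  have hi := h.intervalIntegrable one_pos (by linarith : 0 < x)
  have hsub : Ioc 1 x ⊆ Ioi 0 := fun y hy => mem_Ioi.2 (by linarith [hy.1])
  have h3 : |v x - v 1| ≤ ∫ y in 1..x, |dv y| := by
    rw [h.sub_eq 1 x one_pos (by linarith)]
    exact intervalIntegral.abs_integral_le_integral_abs hx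
  have i2 := h2.mono_set hsub
  have i1 : IntegrableOn (fun _ : ℝ => (1 : ℝ)) (Ioc 1 x) := by simp
  have h4 : ∫ y in 1..x, |dv y| ≤ ∫ y in Ioc 1 x, (1 + dv y ^ 2 * y ^ (2 * lam)) := by
    rw [intervalIntegral.integral_of_le hx]
    refine setIntegral_mono_on ?_ (i1.add i2) measurableSet_Ioc fun y hy => ?_
    · exact ((intervalIntegrable_iff_integrableOn_Ioc_of_le hx).1 hi).abs
    · have h5 := Real.one_le_rpow hy.1.le (by linarith : 0 ≤ 2 * lam)
      have h6 : dv y ^ 2 ≤ dv y ^ 2 * y ^ (2 * lam) := le_mul_of_one_le_right (sq_nonneg _) h5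
      nlinarith [sq_abs (dv y), sq_nonneg (|dv y| - 1), abs_nonneg (dv y)]
  rw [integral_add i1 i2, setIntegral_const, smul_eq_mul, mul_one] at h4
  have h5 : ∫ y in Ioc 1 x, dv y ^ 2 * y ^ (2 * lam) ≤ ∫ y in Ioi 0, dv y ^ 2 * y ^ (2 * lam) := by
    refine setIntegral_mono_set h2 ?_ (Eventually.of_forall hsub)
    filter_upwards [ae_restrict_mem measurableSet_Ioi] with y (hy : 0 < y)
    exact mul_nonneg (sq_nonneg _) (Real.rpow_nonneg hy.le _)
  have h7 : volume.real (Ioc 1 x) = x - 1 := by simp [hx]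
  have h6 := abs_sub_abs_le_abs_sub (v x) (v 1)
  linarith

/-- A classical solution of `(x ^ (2 λ) u')' = x ^ (2 λ) (s u - f)` on `(0, ∞)` whose flux
`x ^ (2 λ) u'` is `O(x ^ (2 λ + 1))` at the origin and decays exponentially at infinity is a weak
solution: no boundary terms survive the integration by parts. -/
theorem solvesBesselResolvent_of_hasDerivAt {lam s k C : ℝ} (hlam : 0 < lam) (hk : 0 < k)
    {f u du : ℝ → ℝ} (hu : HasEnergyDeriv lam u du) (hf : MemLp f 2 (besselMeasure lam))
    (huc : ContinuousOn u (Ioi 0)) (hfc : ContinuousOn f (Ioi 0))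
    (hderiv : ∀ x : ℝ, 0 < x → HasDerivAt (fun x => x ^ (2 * lam) * du x)
      (x ^ (2 * lam) * (s * u x - f x)) x)
    (h0 : ∀ x ∈ Ioc (0 : ℝ) 1, |du x| ≤ C * x)
    (hinf : ∀ x : ℝ, 1 ≤ x → |du x| ≤ C * Real.exp (-k * x)) :
    SolvesBesselResolvent lam s f u := by
  refine ⟨du, hu, fun v dv hv => ?_⟩
  have i1 := hu.memLp_deriv.integrable_mul hv.memLp_deriv
  have i2 := (hu.memLp.integrable_mul hv.memLp).const_mul s
  have i3 := hf.integrable_mul hv.memLp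
  have i4 : Integrable (fun x => du x * dv x + s * (u x * v x) - f x * v x) (besselMeasure lam) :=
    (i1.add i2).sub i3
  have hC : 0 ≤ C := by
    have := (abs_nonneg _).trans (h0 1 (by simp))
    linarith
  suffices hz : ∫ x, (du x * dv x + s * (u x * v x) - f x * v x) ∂(besselMeasure lam) = 0 by
    have e1 : ∫ x, (du x * dv x + s * (u x * v x) - f x * v x) ∂(besselMeasure lam)
        = (∫ x, du x * dv x ∂(besselMeasure lam)) + s * (∫ x, u x * v x ∂(besselMeasure lam))
          - ∫ x, f x * v x ∂(besselMeasure lam) := by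
      rw [← integral_const_mul]
      exact (integral_sub (i1.add i2) i3).trans (congrArg₂ _ (integral_add i1 i2) rfl)
    linarith
  rw [integral_besselMeasure]
  set G : ℝ → ℝ := fun x => (du x * dv x + s * (u x * v x) - f x * v x) * x ^ (2 * lam) with hG
  have hGi : IntegrableOn G (Ioi 0) := integrable_besselMeasure_iff.1 i4
  set B : ℝ → ℝ := fun x => x ^ (2 * lam) * du x * v x with hB
  have hsub : ∀ a b : ℝ, 0 < a → 0 < b → uIcc a b ⊆ Ioi 0 := fun a b ha hb x hx =>
    lt_of_lt_of_le (lt_min ha hb) hx.1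
  have hFc : ContinuousOn (fun x => x ^ (2 * lam) * (s * u x - f x)) (Ioi 0) := by
    refine ContinuousOn.mul (fun x hx => ?_) ((continuousOn_const.mul huc).sub hfc)
    exact (Real.continuousAt_rpow_const x _ (Or.inl (ne_of_gt hx))).continuousWithinAt
  have hint : ∀ a b : ℝ, 0 < a → 0 < b → ∫ x in a..b, G x = B b - B a := by
    intro a b ha hb
    rw [← integral_deriv_mul_add_mul_deriv_of_primitive
      (F := fun x => x ^ (2 * lam) * du x) (F' := fun x => x ^ (2 * lam) * (s * u x - f x))
      (hFc.mono (hsub a b ha hb)).intervalIntegrable (hv.intervalIntegrable ha hb) ?_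
      fun x hx => hv.sub_eq a x ha (hsub a b ha hb hx)]
    · refine intervalIntegral.integral_congr fun x _ => ?_
      simp only [hG]
      ring
    · intro x hx
      have hx0 : 0 < x := hsub a b ha hb hx
      exact (intervalIntegral.integral_eq_sub_of_hasDerivAt
        (fun y hy => hderiv y (hsub a x ha hx0 hy))
        (hFc.mono (hsub a x ha hx0)).intervalIntegrable).symm
  have hB0 : Tendsto B (𝓝[>] 0) (𝓝 0) := by
    obtain ⟨M, hM⟩ := hv.exists_rpow_mul_abs_le hlam
    have ht : Tendsto (fun x : ℝ => C * x * M) (𝓝[>] 0) (𝓝 0) := by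
      have : Continuous fun x : ℝ => C * x * M := by fun_prop
      have h := this.tendsto 0
      simp only [mul_zero, zero_mul] at h
      exact h.mono_left nhdsWithin_le_nhds
    refine squeeze_zero_norm' ?_ ht
    filter_upwards [Ioc_mem_nhdsGT (zero_lt_one' ℝ)] with x hx
    have h1 : 0 < x ^ (2 * lam) := Real.rpow_pos_of_pos hx.1 _
    rw [Real.norm_eq_abs, hB, abs_mul, abs_mul, abs_of_pos h1, mul_comm (x ^ (2 * lam)), mul_assoc]
    exact mul_le_mul (h0 x hx) (hM x hx) (by positivity) (mul_nonneg hC hx.1.le)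
  have hBinf : Tendsto B atTop (𝓝 0) := by
    obtain ⟨M, hM⟩ := hv.exists_abs_le hlam
    have ht : Tendsto (fun x : ℝ => C * (M * (x ^ (2 * lam) * Real.exp (-k * x))
        + x ^ (2 * lam + 1) * Real.exp (-k * x))) atTop (𝓝 0) := by
      have h := (((tendsto_rpow_mul_exp_neg_mul_atTop_nhds_zero (2 * lam) k hk).const_mul M).add
        (tendsto_rpow_mul_exp_neg_mul_atTop_nhds_zero (2 * lam + 1) k hk)).const_mul C
      simpa using h
    refine squeeze_zero_norm' ?_ ht
    filter_upwards [eventually_ge_atTop 1] with x hx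
    have h1 : 0 < x ^ (2 * lam) := Real.rpow_pos_of_pos (by linarith) _
    rw [Real.norm_eq_abs, hB, abs_mul, abs_mul, abs_of_pos h1]
    calc x ^ (2 * lam) * |du x| * |v x|
        ≤ x ^ (2 * lam) * (C * Real.exp (-k * x)) * (M + x) := by
          have := hinf x hx
          have := hM x hx
          gcongr
      _ = _ := by
          rw [Real.rpow_add_one (by linarith)]
          ring
  have ha : Tendsto (fun n : ℕ => 1 / ((n : ℝ) + 1)) atTop (𝓝[>] 0) :=
    tendsto_nhdsWithin_iff.2 ⟨tendsto_one_div_add_atTop_nhds_zero_nat,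
      Eventually.of_forall fun n => mem_Ioi.2 (by positivity)⟩
  have hb : Tendsto (fun n : ℕ => (n : ℝ) + 1) atTop atTop :=
    tendsto_atTop_add_const_right _ _ tendsto_natCast_atTop_atTop
  have hlim1 : Tendsto (fun n : ℕ => ∫ x in (1 / ((n : ℝ) + 1))..((n : ℝ) + 1), G x) atTop
      (𝓝 0) := by
    have h := (hBinf.comp hb).sub (hB0.comp ha)
    rw [sub_zero] at h
    refine h.congr fun n => ?_
    rw [hint _ _ (by positivity) (by positivity)]
    rfl
  have hle : ∀ n : ℕ, 1 / ((n : ℝ) + 1) ≤ (n : ℝ) + 1 := fun n => by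
    have h1 : (1 : ℝ) ≤ (n : ℝ) + 1 := by
      have : (0 : ℝ) ≤ n := n.cast_nonneg
      linarith
    exact ((div_le_one (by linarith)).2 h1).trans h1
  have hlim2 : Tendsto (fun n : ℕ => ∫ x in (1 / ((n : ℝ) + 1))..((n : ℝ) + 1), G x) atTop
      (𝓝 (∫ x in Ioi 0, G x)) := by
    have hU : ⋃ n : ℕ, Ioc (1 / ((n : ℝ) + 1)) ((n : ℝ) + 1) = Ioi 0 := by
      refine Subset.antisymm (iUnion_subset fun n x hx => ?_) fun x (hx : 0 < x) => ?_
      · exact mem_Ioi.2 (lt_trans (by positivity) hx.1)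
      · obtain ⟨n, h1, h2⟩ := (((tendsto_one_div_add_atTop_nhds_zero_nat (𝕜 := ℝ)).eventually
          (gt_mem_nhds hx)).and (hb.eventually_ge_atTop x)).exists
        exact mem_iUnion.2 ⟨n, h1, h2⟩
    have hmono : Monotone fun n : ℕ => Ioc (1 / ((n : ℝ) + 1)) ((n : ℝ) + 1) := by
      intro m n hmn
      have h1 : (m : ℝ) ≤ n := Nat.cast_le.2 hmn
      refine Ioc_subset_Ioc ?_ (by linarith)
      exact one_div_le_one_div_of_le (by positivity) (by linarith)
    have h := tendsto_setIntegral_of_monotone (μ := volume) (f := G)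
      (fun n => measurableSet_Ioc) hmono (by rw [hU]; exact hGi)
    rw [hU] at h
    refine h.congr fun n => ?_
    rw [intervalIntegral.integral_of_le (hle n)]
  exact tendsto_nhds_unique hlim2 hlim1

/-! ### The resolvent kernel -/

theorem memLp_two_besselMeasure_of_abs_le_exp {lam k C : ℝ} (hlam : 0 < lam) (hk : 0 < k)
    {g : ℝ → ℝ} (hg : ContinuousOn g (Ioi 0))
    (hb : ∀ x : ℝ, 0 < x → |g x| ≤ C * Real.exp (-k * x)) : MemLp g 2 (besselMeasure lam) := by
  have hac : besselMeasure lam ≪ volume.restrict (Ioi 0) := withDensity_absolutelyContinuous _ _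
  have hm : AEStronglyMeasurable g (besselMeasure lam) :=
    (hg.aestronglyMeasurable measurableSet_Ioi).mono_ac hac
  rw [memLp_two_iff_integrable_sq hm]
  have hi : Integrable (fun x => C ^ 2 * Real.exp (-(2 * k) * x)) (besselMeasure lam) := by
    rw [integrable_besselMeasure_iff]
    have h := (integrableOn_rpow_mul_exp_neg_mul_rpow (s := 2 * lam) (p := 1) (b := 2 * k)
      (by linarith) one_pos (by linarith)).const_mul (C ^ 2)
    refine h.congr (ae_of_all _ fun x => ?_)
    simp only [Real.rpow_one]
    ring
  refine hi.mono' (hm.pow 2) ?_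
  filter_upwards [hac.ae_le (ae_restrict_mem measurableSet_Ioi)] with x hx
  have h1 := hb x hx
  have h2 : Real.exp (-(2 * k) * x) = Real.exp (-k * x) ^ 2 := by
    rw [← Real.exp_nat_mul]
    congr 1
    push_cast
    ring
  rw [Real.norm_eq_abs, abs_pow, h2, ← mul_pow]
  exact pow_le_pow_left₀ (abs_nonneg _) h1 2

theorem integrableOn_Ioi_of_support_subset {h : ℝ → ℝ} (hc : ContinuousOn h (Ioi 0))
    (hs : ∀ x, x ∉ Icc (1 : ℝ) 2 → h x = 0) : IntegrableOn h (Ioi 0) := by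
  have h1 : IntegrableOn h (Icc 1 2) :=
    (hc.mono fun x hx => mem_Ioi.2 (by linarith [hx.1])).integrableOn_Icc
  exact (h1.integrable_of_forall_notMem_eq_zero hs).integrableOn

theorem abs_intervalIntegral_le_integral_Ioi {h : ℝ → ℝ} (hi : IntegrableOn h (Ioi 0)) {a b : ℝ}
    (ha : 0 < a) (hb : 0 < b) : |∫ x in a..b, h x| ≤ ∫ x in Ioi 0, |h x| :=
  (intervalIntegral.norm_integral_le_integral_norm_uIoc (f := h)).trans
    (setIntegral_mono_set hi.abs (ae_of_all _ fun _ => abs_nonneg _)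
      (Eventually.of_forall fun _ hx => lt_trans (lt_min ha hb) hx.1))

theorem hasDerivAt_intervalIntegral_of_continuousOn_Ioi {h : ℝ → ℝ} (hc : ContinuousOn h (Ioi 0))
    {a x : ℝ} (ha : 0 < a) (hx : 0 < x) : HasDerivAt (fun x => ∫ y in a..x, h y) (h x) x := by
  refine intervalIntegral.integral_hasDerivAt_right
    (hc.mono fun y hy => lt_of_lt_of_le (lt_min ha hx) hy.1).intervalIntegrable
    (hc.stronglyMeasurableAtFilter isOpen_Ioi x hx) (hc.continuousAt (Ioi_mem_nhds hx))

theorem intervalIntegral_eq_zero_of_support {h : ℝ → ℝ} {a b : ℝ}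
    (hz : ∀ x ∈ uIcc a b, x ≠ 1 → x ≠ 2 → h x = 0) : ∫ x in a..b, h x = 0 := by
  have h1 : ∀ᵐ x ∂(volume : Measure ℝ), x ≠ 1 := by simp [ae_iff, measure_singleton]
  have h2 : ∀ᵐ x ∂(volume : Measure ℝ), x ≠ 2 := by simp [ae_iff, measure_singleton]
  refine intervalIntegral.integral_zero_ae ?_
  filter_upwards [h1, h2] with x h1 h2 hx using hz x (uIoc_subset_uIcc hx) h1 h2

/-- `∫_1^x ψ(k y) f(y) dμ(y)`. For `f` supported in `[1, 2]` this is also the integral over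
`(0, x)`. -/
def growthMoment (lam k : ℝ) (f : ℝ → ℝ) (x : ℝ) : ℝ :=
  ∫ y in 1..x, besselGrowth lam 0 (k * y) * f y * y ^ (2 * lam)

/-- `∫_2^x φ(k y) f(y) dμ(y)`. For `f` supported in `[1, 2]` this is minus the integral over
`(x, ∞)`. -/
def decayMoment (lam k : ℝ) (f : ℝ → ℝ) (x : ℝ) : ℝ :=
  ∫ y in 2..x, besselDecay lam 0 (k * y) * f y * y ^ (2 * lam)

/-- The solution of `(k² + Δ) u = f` given by variation of constants, for `f` supported
in `[1, 2]`. -/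
def besselGreen (lam k : ℝ) (f : ℝ → ℝ) (x : ℝ) : ℝ :=
  k ^ (2 * lam - 1) / besselWronskian lam *
    (besselDecay lam 0 (k * x) * growthMoment lam k f x
      - besselGrowth lam 0 (k * x) * decayMoment lam k f x)

/-- The derivative of `besselGreen`. -/
def besselGreenDeriv (lam k : ℝ) (f : ℝ → ℝ) (x : ℝ) : ℝ :=
  k ^ (2 * lam - 1) / besselWronskian lam *
    (k * (-(besselDecay lam 1 (k * x) * growthMoment lam k f x)
      - besselGrowth lam 1 (k * x) * decayMoment lam k f x))

theorem hasDerivAt_besselDecay_comp_mul {lam k x : ℝ} (hlam : 0 < lam) (hk : 0 < k) (hx : 0 < x)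
    (n : ℕ) : HasDerivAt (fun x => besselDecay lam n (k * x))
      (-(k * besselDecay lam (n + 1) (k * x))) x := by
  have h := (hasDerivAt_besselDecay hlam (mul_pos hk hx) n).comp x ((hasDerivAt_id x).const_mul k)
  refine h.congr_deriv ?_
  ring

theorem hasDerivAt_besselGrowth_comp_mul {lam : ℝ} (hlam : 0 < lam) (k x : ℝ) (n : ℕ) :
    HasDerivAt (fun x => besselGrowth lam n (k * x)) (k * besselGrowth lam (n + 1) (k * x)) x := by
  have h := (hasDerivAt_besselGrowth hlam (k * x) n).comp x ((hasDerivAt_id x).const_mul k)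
  refine h.congr_deriv ?_
  ring

section

variable {lam k : ℝ} {f : ℝ → ℝ}

theorem continuousOn_rpow_Ioi (a : ℝ) : ContinuousOn (fun x : ℝ => x ^ a) (Ioi 0) := fun x hx =>
  (Real.continuousAt_rpow_const x _ (Or.inl (ne_of_gt hx))).continuousWithinAt

theorem continuousOn_growthMoment_integrand (hlam : 0 < lam) (hf : ContinuousOn f (Ioi 0)) :
    ContinuousOn (fun y => besselGrowth lam 0 (k * y) * f y * y ^ (2 * lam)) (Ioi 0) :=
  ContinuousOn.mul (ContinuousOn.mul (fun y _ =>
    (hasDerivAt_besselGrowth_comp_mul hlam k y 0).continuousAt.continuousWithinAt) hf)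
    (continuousOn_rpow_Ioi _)

theorem continuousOn_decayMoment_integrand (hlam : 0 < lam) (hk : 0 < k)
    (hf : ContinuousOn f (Ioi 0)) :
    ContinuousOn (fun y => besselDecay lam 0 (k * y) * f y * y ^ (2 * lam)) (Ioi 0) :=
  ContinuousOn.mul (ContinuousOn.mul (fun _ hy =>
    (hasDerivAt_besselDecay_comp_mul hlam hk hy 0).continuousAt.continuousWithinAt) hf)
    (continuousOn_rpow_Ioi _)

theorem hasDerivAt_growthMoment (hlam : 0 < lam) (hf : ContinuousOn f (Ioi 0)) {x : ℝ}
    (hx : 0 < x) : HasDerivAt (growthMoment lam k f)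
      (besselGrowth lam 0 (k * x) * f x * x ^ (2 * lam)) x :=
  hasDerivAt_intervalIntegral_of_continuousOn_Ioi (continuousOn_growthMoment_integrand hlam hf)
    one_pos hx

theorem hasDerivAt_decayMoment (hlam : 0 < lam) (hk : 0 < k) (hf : ContinuousOn f (Ioi 0)) {x : ℝ}
    (hx : 0 < x) : HasDerivAt (decayMoment lam k f)
      (besselDecay lam 0 (k * x) * f x * x ^ (2 * lam)) x :=
  hasDerivAt_intervalIntegral_of_continuousOn_Ioi (continuousOn_decayMoment_integrand hlam hk hf)
    two_pos hx

theorem growthMoment_eq_zero (hs : ∀ x, x ∉ Icc (1 : ℝ) 2 → f x = 0) {x : ℝ} (hx : x ≤ 1) :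
    growthMoment lam k f x = 0 := by
  refine intervalIntegral_eq_zero_of_support fun y hy h1 _ => ?_
  rw [uIcc_of_ge hx] at hy
  rw [hs y fun h => h1 (le_antisymm hy.2 h.1)]
  ring

theorem decayMoment_eq_zero (hs : ∀ x, x ∉ Icc (1 : ℝ) 2 → f x = 0) {x : ℝ} (hx : 2 ≤ x) :
    decayMoment lam k f x = 0 := by
  refine intervalIntegral_eq_zero_of_support fun y hy _ h2 => ?_
  rw [uIcc_of_le hx] at hy
  rw [hs y fun h => h2 (le_antisymm h.2 hy.1)]
  ring

theorem growthMoment_eq_two (hlam : 0 < lam) (hf : ContinuousOn f (Ioi 0))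
    (hs : ∀ x, x ∉ Icc (1 : ℝ) 2 → f x = 0) {x : ℝ} (hx : 2 ≤ x) :
    growthMoment lam k f x = growthMoment lam k f 2 := by
  have hi : ∀ a b : ℝ, 0 < a → 0 < b → IntervalIntegrable
      (fun y => besselGrowth lam 0 (k * y) * f y * y ^ (2 * lam)) volume a b := fun a b ha hb =>
    ((continuousOn_growthMoment_integrand hlam hf).mono
      fun y hy => lt_of_lt_of_le (lt_min ha hb) hy.1).intervalIntegrable
  rw [growthMoment, growthMoment, ← sub_eq_zero, intervalIntegral.integral_interval_sub_left
    (hi 1 x one_pos (by linarith)) (hi 1 2 one_pos two_pos)]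
  refine intervalIntegral_eq_zero_of_support fun y hy _ h2 => ?_
  rw [uIcc_of_le hx] at hy
  rw [hs y fun h => h2 (le_antisymm h.2 hy.1)]
  ring

theorem hasDerivAt_besselGreen (hlam : 0 < lam) (hk : 0 < k) (hf : ContinuousOn f (Ioi 0)) {x : ℝ}
    (hx : 0 < x) : HasDerivAt (besselGreen lam k f) (besselGreenDeriv lam k f x) x := by
  refine ((((hasDerivAt_besselDecay_comp_mul hlam hk hx 0).mul
    (hasDerivAt_growthMoment hlam hf hx)).sub ((hasDerivAt_besselGrowth_comp_mul hlam k x 0).mul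
      (hasDerivAt_decayMoment hlam hk hf hx))).const_mul _).congr_deriv ?_
  rw [besselGreenDeriv]
  simp only [zero_add]
  ring

/-- `besselGreen` is a classical solution of `(x ^ (2 λ) u')' = x ^ (2 λ) (k² u - f)`: the
homogeneous terms vanish by the differential equations of `φ` and `ψ`, and the Wronskian normalizes
the source term. -/
theorem hasDerivAt_besselGreenDeriv (hlam : 0 < lam) (hk : 0 < k) (hf : ContinuousOn f (Ioi 0))
    {x : ℝ} (hx : 0 < x) : HasDerivAt (fun x => x ^ (2 * lam) * besselGreenDeriv lam k f x)
      (x ^ (2 * lam) * (k ^ 2 * besselGreen lam k f x - f x)) x := by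
  have h1 := (((((hasDerivAt_besselDecay_comp_mul hlam hk hx 1).mul
    (hasDerivAt_growthMoment (k := k) hlam hf hx)).neg).sub
      ((hasDerivAt_besselGrowth_comp_mul hlam k x 1).mul
      (hasDerivAt_decayMoment hlam hk hf hx))).const_mul k).const_mul
        (k ^ (2 * lam - 1) / besselWronskian lam)
  refine ((Real.hasDerivAt_rpow_const (p := 2 * lam) (Or.inl hx.ne')).mul h1).congr_deriv ?_
  have hW := besselWronskian_pos hlam
  have e1 := besselDecay_ode hlam (mul_pos hk hx)
  have e2 := besselGrowth_ode hlam (k * x)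
  have e3 := rpow_mul_eq_besselWronskian hlam (mul_pos hk hx)
  rw [Real.mul_rpow hk.le hx.le] at e3
  have e4 : x ^ (2 * lam) = x ^ (2 * lam - 1) * x := by
    rw [Real.rpow_sub_one hx.ne']; field_simp
  have e5 : k ^ (2 * lam) = k ^ (2 * lam - 1) * k := by
    rw [Real.rpow_sub_one hk.ne']; field_simp
  rw [besselGreen]
  simp only [Nat.reduceAdd, Pi.mul_apply, Pi.sub_apply, Pi.neg_apply]
  rw [e5] at e3
  rw [e4] at e3 ⊢
  generalize besselDecay lam 0 (k * x) = D0 at *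
  generalize besselDecay lam 1 (k * x) = D1 at *
  generalize besselDecay lam 2 (k * x) = D2 at *
  generalize besselGrowth lam 0 (k * x) = G0 at *
  generalize besselGrowth lam 1 (k * x) = G1 at *
  generalize besselGrowth lam 2 (k * x) = G2 at *
  generalize growthMoment lam k f x = A at *
  generalize decayMoment lam k f x = B at *
  generalize besselWronskian lam = W at *
  generalize k ^ (2 * lam - 1) = K at *
  generalize x ^ (2 * lam - 1) = X at *
  field_simp
  linear_combination (X * K * k * A) * e1 + (X * K * k * B) * e2 - (X * x * f x) * e3

theorem exists_abs_growthMoment_le (hlam : 0 < lam) (hf : ContinuousOn f (Ioi 0))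
    (hs : ∀ x, x ∉ Icc (1 : ℝ) 2 → f x = 0) :
    ∃ M : ℝ, 0 ≤ M ∧ ∀ x : ℝ, 0 < x → |growthMoment lam k f x| ≤ M :=
  ⟨_, setIntegral_nonneg measurableSet_Ioi fun _ _ => abs_nonneg _, fun _ hx =>
    abs_intervalIntegral_le_integral_Ioi (integrableOn_Ioi_of_support_subset
      (continuousOn_growthMoment_integrand hlam hf) fun y hy => by rw [hs y hy]; ring) one_pos hx⟩

theorem exists_abs_decayMoment_le (hlam : 0 < lam) (hk : 0 < k) (hf : ContinuousOn f (Ioi 0))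
    (hs : ∀ x, x ∉ Icc (1 : ℝ) 2 → f x = 0) :
    ∃ M : ℝ, 0 ≤ M ∧ ∀ x : ℝ, 0 < x → |decayMoment lam k f x| ≤ M :=
  ⟨_, setIntegral_nonneg measurableSet_Ioi fun _ _ => abs_nonneg _, fun _ hx =>
    abs_intervalIntegral_le_integral_Ioi (integrableOn_Ioi_of_support_subset
      (continuousOn_decayMoment_integrand hlam hk hf) fun y hy => by rw [hs y hy]; ring) two_pos hx⟩

theorem exists_abs_decay_mul_growthMoment_le (hlam : 0 < lam) (hk : 0 < k)
    (hf : ContinuousOn f (Ioi 0)) (hs : ∀ x, x ∉ Icc (1 : ℝ) 2 → f x = 0) (n : ℕ) :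
    ∃ C : ℝ, 0 ≤ C ∧ ∀ x : ℝ, 0 < x →
      |besselDecay lam n (k * x) * growthMoment lam k f x| ≤ C * Real.exp (-k * x) := by
  obtain ⟨M, hM0, hM⟩ := exists_abs_growthMoment_le (k := k) hlam hf hs
  have hD := besselDecay_pos hlam hk n
  refine ⟨Real.exp k * besselDecay lam n k * M, by positivity, fun x hx => ?_⟩
  rcases le_total x 1 with h | h
  · rw [growthMoment_eq_zero hs h, mul_zero, abs_zero]
    positivity
  · have h1 := besselDecay_add_le (h := k * x - k) hlam hk (by nlinarith) n
    rw [add_sub_cancel, show -(k * x - k) = k + -k * x by ring, Real.exp_add] at h1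
    rw [abs_mul, abs_of_pos (besselDecay_pos hlam (mul_pos hk hx) n)]
    calc besselDecay lam n (k * x) * |growthMoment lam k f x|
        ≤ (Real.exp k * Real.exp (-k * x) * besselDecay lam n k) * M := by
          gcongr
          exact hM x hx
      _ = _ := by ring

theorem exists_abs_growth_mul_decayMoment_le (hlam : 0 < lam) (hk : 0 < k)
    (hf : ContinuousOn f (Ioi 0)) (hs : ∀ x, x ∉ Icc (1 : ℝ) 2 → f x = 0) {g : ℝ → ℝ}
    (hg : Continuous g) :
    ∃ C : ℝ, 0 ≤ C ∧ ∀ x : ℝ, 0 < x →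
      |g (k * x) * decayMoment lam k f x| ≤ C * Real.exp (-k * x) := by
  obtain ⟨M, hM0, hM⟩ := exists_abs_decayMoment_le hlam hk hf hs
  obtain ⟨N, hN⟩ := (isCompact_Icc (a := 0) (b := k * 2)).exists_bound_of_continuousOn
    hg.continuousOn
  have hN0 : 0 ≤ N := (norm_nonneg _).trans (hN 0 (by simp [hk.le]))
  refine ⟨Real.exp (k * 2) * N * M, by positivity, fun x hx => ?_⟩
  rcases le_total 2 x with h | h
  · rw [decayMoment_eq_zero hs h, mul_zero, abs_zero]
    positivity
  · have h1 := hN (k * x) ⟨by positivity, by nlinarith⟩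
    have h2 : 1 ≤ Real.exp (k * 2) * Real.exp (-k * x) := by
      rw [← Real.exp_add]
      exact Real.one_le_exp (by nlinarith)
    rw [abs_mul]
    calc |g (k * x)| * |decayMoment lam k f x| ≤ N * M := by
          gcongr
          · exact h1
          · exact hM x hx
      _ ≤ N * M * (Real.exp (k * 2) * Real.exp (-k * x)) :=
          le_mul_of_one_le_right (by positivity) h2
      _ = _ := by ring

theorem exists_abs_besselGreen_le (hlam : 0 < lam) (hk : 0 < k)
    (hf : ContinuousOn f (Ioi 0)) (hs : ∀ x, x ∉ Icc (1 : ℝ) 2 → f x = 0) :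
    ∃ C : ℝ, ∀ x : ℝ, 0 < x → |besselGreen lam k f x| ≤ C * Real.exp (-k * x) := by
  obtain ⟨C1, hC1, h1⟩ := exists_abs_decay_mul_growthMoment_le hlam hk hf hs 0
  obtain ⟨C2, hC2, h2⟩ := exists_abs_growth_mul_decayMoment_le hlam hk hf hs
    (continuous_iff_continuousAt.2 fun x => (hasDerivAt_besselGrowth hlam x 0).continuousAt)
  refine ⟨|k ^ (2 * lam - 1) / besselWronskian lam| * (C1 + C2), fun x hx => ?_⟩
  rw [besselGreen, abs_mul, mul_assoc]
  refine mul_le_mul_of_nonneg_left ((abs_sub _ _).trans ?_) (abs_nonneg _)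
  rw [add_mul]
  exact add_le_add (h1 x hx) (h2 x hx)

theorem exists_abs_besselGreenDeriv_le (hlam : 0 < lam) (hk : 0 < k)
    (hf : ContinuousOn f (Ioi 0)) (hs : ∀ x, x ∉ Icc (1 : ℝ) 2 → f x = 0) :
    ∃ C : ℝ, ∀ x : ℝ, 0 < x → |besselGreenDeriv lam k f x| ≤ C * Real.exp (-k * x) := by
  obtain ⟨C1, hC1, h1⟩ := exists_abs_decay_mul_growthMoment_le hlam hk hf hs 1
  obtain ⟨C2, hC2, h2⟩ := exists_abs_growth_mul_decayMoment_le hlam hk hf hs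
    (continuous_iff_continuousAt.2 fun x => (hasDerivAt_besselGrowth hlam x 1).continuousAt)
  refine ⟨|k ^ (2 * lam - 1) / besselWronskian lam| * (k * (C1 + C2)), fun x hx => ?_⟩
  rw [besselGreenDeriv, abs_mul, mul_assoc]
  refine mul_le_mul_of_nonneg_left ?_ (abs_nonneg _)
  rw [abs_mul, abs_of_pos hk, mul_assoc]
  refine mul_le_mul_of_nonneg_left ((abs_sub _ _).trans ?_) hk.le
  rw [add_mul, abs_neg]
  exact add_le_add (h1 x hx) (h2 x hx)

/-- Left of the support only the regular solution `ψ` enters, and `ψ'(x) = O(x)`. -/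
theorem exists_abs_besselGreenDeriv_le_mul (hlam : 0 < lam) (hk : 0 < k)
    (hf : ContinuousOn f (Ioi 0)) (hs : ∀ x, x ∉ Icc (1 : ℝ) 2 → f x = 0) :
    ∃ C : ℝ, ∀ x ∈ Ioc (0 : ℝ) 1, |besselGreenDeriv lam k f x| ≤ C * x := by
  obtain ⟨M, hM0, hM⟩ := exists_abs_decayMoment_le hlam hk hf hs
  have hG := besselGrowth_zero_zero_pos hlam
  refine ⟨|k ^ (2 * lam - 1) / besselWronskian lam| *
    (k * (k * (besselGrowth lam 0 0 * Real.exp k) / (2 * lam) * M)), fun x hx => ?_⟩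
  have hkx : 0 ≤ k * x := mul_nonneg hk.le hx.1.le
  have h1 : besselGrowth lam 1 (k * x)
      ≤ k * x * (besselGrowth lam 0 0 * Real.exp k) / (2 * lam) := by
    refine (besselGrowth_one_le hlam hkx).trans ?_
    have h2 := (besselGrowth_zero_le_exp hlam hkx).trans (mul_le_mul_of_nonneg_left
      (Real.exp_le_exp.2 (by nlinarith [hx.2] : k * x ≤ k)) hG.le)
    gcongr
  rw [besselGreenDeriv, growthMoment_eq_zero hs hx.2, abs_mul, mul_zero, neg_zero, zero_sub,
    mul_assoc]
  refine mul_le_mul_of_nonneg_left ?_ (abs_nonneg _)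
  rw [abs_mul, abs_of_pos hk, mul_assoc, abs_neg, abs_mul,
    abs_of_nonneg (besselGrowth_one_nonneg hlam hkx)]
  refine mul_le_mul_of_nonneg_left ?_ hk.le
  calc besselGrowth lam 1 (k * x) * |decayMoment lam k f x|
      ≤ (k * x * (besselGrowth lam 0 0 * Real.exp k) / (2 * lam)) * M :=
        mul_le_mul h1 (hM x hx.1) (abs_nonneg _) (by positivity)
    _ = _ := by ring

theorem solvesBesselResolvent_besselGreen (hlam : 0 < lam) (hk : 0 < k)
    (hf : ContinuousOn f (Ioi 0)) (hs : ∀ x, x ∉ Icc (1 : ℝ) 2 → f x = 0) :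
    SolvesBesselResolvent lam (k ^ 2) f (besselGreen lam k f) := by
  obtain ⟨C0, h0⟩ := exists_abs_besselGreen_le hlam hk hf hs
  obtain ⟨C1, h1⟩ := exists_abs_besselGreenDeriv_le hlam hk hf hs
  obtain ⟨C2, h2⟩ := exists_abs_besselGreenDeriv_le_mul hlam hk hf hs
  have huc : ContinuousOn (besselGreen lam k f) (Ioi 0) := fun x hx =>
    (hasDerivAt_besselGreen hlam hk hf hx).continuousAt.continuousWithinAt
  have hduc : ContinuousOn (besselGreenDeriv lam k f) (Ioi 0) := by
    have h : ContinuousOn (fun x => x ^ (-(2 * lam)) * (x ^ (2 * lam) * besselGreenDeriv lam k f x))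
        (Ioi 0) := (continuousOn_rpow_Ioi _).mul fun x hx =>
      (hasDerivAt_besselGreenDeriv hlam hk hf hx).continuousAt.continuousWithinAt
    refine h.congr fun x (hx : 0 < x) => ?_
    simp only
    rw [← mul_assoc, ← Real.rpow_add hx, neg_add_cancel, Real.rpow_zero, one_mul]
  have hu : HasEnergyDeriv lam (besselGreen lam k f) (besselGreenDeriv lam k f) := by
    refine ⟨memLp_two_besselMeasure_of_abs_le_exp hlam hk huc h0,
      memLp_two_besselMeasure_of_abs_le_exp hlam hk hduc h1, fun a b ha hb => ?_⟩
    have hsub : uIcc a b ⊆ Ioi 0 := fun y hy => lt_of_lt_of_le (lt_min ha hb) hy.1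
    exact (intervalIntegral.integral_eq_sub_of_hasDerivAt
      (fun y hy => hasDerivAt_besselGreen hlam hk hf (hsub hy))
      (hduc.mono hsub).intervalIntegrable).symm
  have hfm : MemLp f 2 (besselMeasure lam) := by
    obtain ⟨M, hM⟩ := (isCompact_Icc (a := (1 : ℝ)) (b := 2)).exists_bound_of_continuousOn
      (hf.mono fun x hx => mem_Ioi.2 (by linarith [hx.1]))
    have hM0 : 0 ≤ M := (norm_nonneg _).trans (hM 1 (by simp))
    refine memLp_two_besselMeasure_of_abs_le_exp (k := 1) (C := M * Real.exp 2) hlam one_pos hf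
      fun x _ => ?_
    by_cases hx : x ∈ Icc (1 : ℝ) 2
    · have h3 : 1 ≤ Real.exp 2 * Real.exp (-1 * x) := by
        rw [← Real.exp_add]
        exact Real.one_le_exp (by linarith [hx.2])
      rw [mul_assoc]
      exact (hM x hx).trans (le_mul_of_one_le_right hM0 h3)
    · rw [hs x hx, abs_zero]
      positivity
  refine solvesBesselResolvent_of_hasDerivAt (C := max C1 C2) hlam hk hu hfm huc hf
    (fun x hx => hasDerivAt_besselGreenDeriv hlam hk hf hx) (fun x hx => ?_) fun x hx => ?_
  · exact (h2 x hx).trans (mul_le_mul_of_nonneg_right (le_max_right _ _) hx.1.le)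
  · exact (h1 x (by linarith)).trans
      (mul_le_mul_of_nonneg_right (le_max_left _ _) (Real.exp_pos _).le)

theorem besselResolvent_eq_besselGreen (hlam : 0 < lam) (hk : 0 < k)
    (hf : ContinuousOn f (Ioi 0)) (hs : ∀ x, x ∉ Icc (1 : ℝ) 2 → f x = 0) {x : ℝ} (hx : 0 < x) :
    besselResolvent lam (k ^ 2) f x = besselGreen lam k f x := by
  have h := solvesBesselResolvent_besselGreen hlam hk hf hs
  have hex : ∃ u : ℝ → ℝ, SolvesBesselResolvent lam (k ^ 2) f u := ⟨_, h⟩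
  rw [besselResolvent, dif_pos hex]
  exact hex.choose_spec.eqOn (by positivity) h hx

end

/-! ### The Riesz transform to the right of the support -/

section

variable {lam : ℝ} {f : ℝ → ℝ}

theorem continuous_besselGrowth (hlam : 0 < lam) (n : ℕ) : Continuous (besselGrowth lam n) :=
  continuous_iff_continuousAt.2 fun x => (hasDerivAt_besselGrowth hlam x n).continuousAt

theorem measurable_growthMoment_two (hlam : 0 < lam) (hm : Measurable f) :
    Measurable fun k => growthMoment lam k f 2 := by
  have hG := continuous_besselGrowth hlam 0
  have h : Measurable (Function.uncurry fun k y : ℝ =>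
      besselGrowth lam 0 (k * y) * f y * y ^ (2 * lam)) := by
    have h1 : Measurable fun p : ℝ × ℝ => besselGrowth lam 0 (p.1 * p.2) :=
      (hG.comp (continuous_fst.mul continuous_snd)).measurable
    exact (h1.mul (hm.comp measurable_snd)).mul (measurable_snd.pow_const _)
  have h2 := h.stronglyMeasurable.integral_prod_right (ν := volume.restrict (Ioc (1 : ℝ) 2))
  simp only [growthMoment, intervalIntegral.integral_of_le one_le_two]
  exact h2.measurable

theorem exists_abs_growthMoment_two_le (hlam : 0 < lam) (hf : ContinuousOn f (Ioi 0)) :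
    ∃ C : ℝ, 0 ≤ C ∧ ∀ k : ℝ, 0 ≤ k → |growthMoment lam k f 2| ≤ C * Real.exp (2 * k) := by
  have hG := besselGrowth_zero_zero_pos hlam
  have hsub : Icc (1 : ℝ) 2 ⊆ Ioi 0 := fun x hx => mem_Ioi.2 (by linarith [hx.1])
  obtain ⟨N, hN⟩ := (isCompact_Icc (a := (1 : ℝ)) (b := 2)).exists_bound_of_continuousOn
    ((hf.mono hsub).mul ((continuousOn_rpow_Ioi (2 * lam)).mono hsub))
  have hN0 : 0 ≤ N := (norm_nonneg _).trans (hN 1 (by simp))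
  refine ⟨besselGrowth lam 0 0 * N, by positivity, fun k hk => ?_⟩
  have h := intervalIntegral.norm_integral_le_of_norm_le_const (a := (1 : ℝ)) (b := 2)
    (f := fun y => besselGrowth lam 0 (k * y) * f y * y ^ (2 * lam))
    (C := besselGrowth lam 0 0 * N * Real.exp (2 * k)) fun y hy => by
      rw [uIoc_of_le one_le_two] at hy
      have h1 := (besselGrowth_zero_le_exp hlam (mul_nonneg hk (by linarith [hy.1]))).trans
        (mul_le_mul_of_nonneg_left (Real.exp_le_exp.2 (by nlinarith [hy.2] : k * y ≤ 2 * k)) hG.le)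
      have h2 : ‖f y * y ^ (2 * lam)‖ ≤ N := hN y (Ioc_subset_Icc_self hy)
      rw [mul_assoc, norm_mul, Real.norm_eq_abs (besselGrowth _ _ _),
        abs_of_pos (besselGrowth_zero_pos hlam _)]
      calc besselGrowth lam 0 (k * y) * ‖f y * y ^ (2 * lam)‖
          ≤ besselGrowth lam 0 0 * Real.exp (2 * k) * N := by gcongr
        _ = _ := by ring
  norm_num at h
  exact h

theorem besselDecay_mul_exp_le (hlam : 0 < lam) {n : ℕ} {C a : ℝ}
    (hC : ∀ r : ℝ, 0 < r → besselDecay lam n r ≤ C * r ^ (-a)) {r x : ℝ} (hr : 0 < r)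
    (hx : 2 < x) :
    besselDecay lam n (r * x) * Real.exp (2 * r)
      ≤ C * ((x - 2) / 2) ^ (-a) * (r ^ (-a) * Real.exp (-((x - 2) / 2) * r)) := by
  have hη : 0 < (x - 2) / 2 := by linarith
  have h1 := besselDecay_add_le (x := r * ((x - 2) / 2)) (h := r * (x - (x - 2) / 2)) hlam
    (by positivity) (mul_nonneg hr.le (by linarith)) n
  have h2 := hC (r * ((x - 2) / 2)) (by positivity)
  rw [Real.mul_rpow hr.le hη.le] at h2
  rw [show r * ((x - 2) / 2) + r * (x - (x - 2) / 2) = r * x by ring] at h1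
  calc besselDecay lam n (r * x) * Real.exp (2 * r)
      ≤ Real.exp (-(r * (x - (x - 2) / 2))) * (C * (r ^ (-a) * ((x - 2) / 2) ^ (-a)))
          * Real.exp (2 * r) := by
        gcongr
        exact h1.trans (by gcongr)
    _ = C * ((x - 2) / 2) ^ (-a) * (r ^ (-a)
          * (Real.exp (-(r * (x - (x - 2) / 2))) * Real.exp (2 * r))) := by ring
    _ = _ := by
        rw [← Real.exp_add]
        ring_nf

theorem continuousOn_besselDecay_sqrt_mul (hlam : 0 < lam) {x : ℝ} (hx : 0 < x) (n : ℕ) :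
    ContinuousOn (fun s => besselDecay lam n (√s * x)) (Ioi 0) := fun s hs =>
  ContinuousAt.continuousWithinAt (ContinuousAt.comp (g := besselDecay lam n)
    (hasDerivAt_besselDecay hlam (mul_pos (Real.sqrt_pos.2 hs) hx) n).continuousAt
    (by fun_prop))

/-- The integrals over the spectral parameter `s` that represent `Δ ^ (-1/2) f(x)` and `R f(x)`
converge for `x > 2`, if `f` is supported in `[1, 2]`: `φ(√s x) ψ(√s y)` decays like
`e^{-√s (x - y)}`, and a power bound on `φ` controls small `s`. -/
theorem integrableOn_rpow_mul_besselDecay_mul (hlam : 0 < lam) {n : ℕ} {C a c : ℝ}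
    (hC : ∀ r : ℝ, 0 < r → besselDecay lam n r ≤ C * r ^ (-a)) (hc : -1 < c - a / 2)
    {x : ℝ} (hx : 2 < x) {g : ℝ → ℝ} (hg : Measurable g) {M : ℝ}
    (hM : ∀ k : ℝ, 0 ≤ k → |g k| ≤ M * Real.exp (2 * k)) :
    IntegrableOn (fun s => s ^ c * (besselDecay lam n (√s * x) * g √s)) (Ioi 0) := by
  have hη : 0 < (x - 2) / 2 := by linarith
  have hM0 : 0 ≤ M := by
    have := (abs_nonneg _).trans (hM 0 le_rfl)
    simpa using this
  have hi := (integrableOn_rpow_mul_exp_neg_mul_rpow (s := c - a / 2) (p := 1 / 2)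
    (b := (x - 2) / 2) hc (by norm_num) hη).const_mul (M * (C * ((x - 2) / 2) ^ (-a)))
  refine hi.mono' ?_ ?_
  · exact ((continuousOn_rpow_Ioi c).aestronglyMeasurable measurableSet_Ioi).mul
      (((continuousOn_besselDecay_sqrt_mul hlam (by linarith) n).aestronglyMeasurable
        measurableSet_Ioi).mul (hg.comp Real.continuous_sqrt.measurable).aestronglyMeasurable)
  · filter_upwards [ae_restrict_mem measurableSet_Ioi] with s (hs : 0 < s)
    have hr : 0 < √s := Real.sqrt_pos.2 hs
    have h1 := besselDecay_mul_exp_le hlam hC hr hx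
    have hD := besselDecay_pos hlam (mul_pos hr (by linarith : 0 < x)) n
    have e1 : √s ^ (-a) = s ^ (-(a / 2)) := by
      rw [Real.sqrt_eq_rpow, ← Real.rpow_mul hs.le]
      congr 1
      ring
    rw [Real.norm_eq_abs, abs_mul, abs_mul, abs_of_pos (Real.rpow_pos_of_pos hs _), abs_of_pos hD]
    calc s ^ c * (besselDecay lam n (√s * x) * |g √s|)
        ≤ s ^ c * (besselDecay lam n (√s * x) * (M * Real.exp (2 * √s))) := by
          gcongr
          exact hM _ hr.le
      _ = s ^ c * M * (besselDecay lam n (√s * x) * Real.exp (2 * √s)) := by ring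
      _ ≤ s ^ c * M * (C * ((x - 2) / 2) ^ (-a) * (√s ^ (-a)
            * Real.exp (-((x - 2) / 2) * √s))) := by gcongr
      _ = _ := by
          rw [e1, sub_eq_add_neg c, Real.rpow_add hs, ← Real.sqrt_eq_rpow]
          ring

/-- Up to a negative constant, `R f(x)` for `f` supported in `[1, 2]` and `x > 2`. -/
def rieszIntegral (lam : ℝ) (f : ℝ → ℝ) (x : ℝ) : ℝ :=
  ∫ s in Ioi (0 : ℝ), s ^ (lam - 1 / 2) * (besselDecay lam 1 (√s * x) * growthMoment lam √s f 2)

theorem integrableOn_rieszIntegrand (hlam : 0 < lam) {x : ℝ} (hx : 2 < x) {g : ℝ → ℝ}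
    (hg : Measurable g) {M : ℝ} (hM : ∀ k : ℝ, 0 ≤ k → |g k| ≤ M * Real.exp (2 * k)) :
    IntegrableOn (fun s => s ^ (lam - 1 / 2) * (besselDecay lam 1 (√s * x) * g √s)) (Ioi 0) :=
  integrableOn_rpow_mul_besselDecay_mul hlam (fun _ hr => besselDecay_one_le hlam hr)
    (by linarith) hx hg hM

theorem besselInvSqrt_eq_of_two_lt (hlam : 0 < lam) (hf : ContinuousOn f (Ioi 0))
    (hs : ∀ x, x ∉ Icc (1 : ℝ) 2 → f x = 0) {x : ℝ} (hx : 2 < x) :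
    besselInvSqrt lam f x = (1 / (Real.pi * besselWronskian lam)) * ∫ s in Ioi (0 : ℝ),
      s ^ (lam - 1) * (besselDecay lam 0 (√s * x) * growthMoment lam √s f 2) := by
  have hW := besselWronskian_pos hlam
  rw [besselInvSqrt, one_div_mul_eq_div, ← one_div_mul_one_div, mul_assoc, ← integral_const_mul,
    one_div_mul_eq_div]
  congr 1
  refine setIntegral_congr_fun measurableSet_Ioi fun s (hs0 : 0 < s) => ?_
  have hr : 0 < √s := Real.sqrt_pos.2 hs0
  have h := besselResolvent_eq_besselGreen hlam hr hf hs (by linarith : 0 < x)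
  rw [Real.sq_sqrt hs0.le] at h
  rw [h, besselGreen, growthMoment_eq_two hlam hf hs hx.le, decayMoment_eq_zero hs hx.le]
  have e1 : s ^ (lam - 1) = s ^ (-(1 / 2) : ℝ) * √s ^ (2 * lam - 1) := by
    rw [Real.sqrt_eq_rpow, ← Real.rpow_mul hs0.le, ← Real.rpow_add hs0]
    congr 1
    ring
  rw [e1]
  ring

/-- For `x > 2` the Balakrishnan integral of `besselGreen` may be differentiated under the integral
sign; as `φ' < 0`, the kernel of `R` is negative there. -/
theorem besselRiesz_eq_of_two_lt (hlam : 0 < lam) (hf : ContinuousOn f (Ioi 0))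
    (hs : ∀ x, x ∉ Icc (1 : ℝ) 2 → f x = 0) (hm : Measurable f) {x : ℝ} (hx : 2 < x) :
    besselRiesz lam f x = -(1 / (Real.pi * besselWronskian lam)) * rieszIntegral lam f x := by
  obtain ⟨M, hM0, hM⟩ := exists_abs_growthMoment_two_le hlam hf
  have hmΨ := measurable_growthMoment_two hlam hm
  -- Any exponent strictly between `max 0 (2 λ - 1)` and `2 λ` serves.
  set a : ℝ := 2 * lam - min lam (1 / 2) with ha
  have hmin : 0 < min lam (1 / 2) := lt_min hlam (by norm_num)
  obtain ⟨C, -, hC⟩ := besselDecay_zero_le_rpow (a := a) hlam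
    (by have := min_le_right lam (1 / 2); linarith) (by have := min_le_left lam (1 / 2); linarith)
  have hx1 : 2 < 1 + x / 2 := by linarith
  have hd := hasDerivAt_integral_of_dominated_loc_of_deriv_le (μ := volume.restrict (Ioi (0 : ℝ)))
    (F := fun x s => s ^ (lam - 1) * (besselDecay lam 0 (√s * x) * growthMoment lam √s f 2))
    (F' := fun x s =>
      -(s ^ (lam - 1 / 2) * (besselDecay lam 1 (√s * x) * growthMoment lam √s f 2)))
    (s := Ioi (1 + x / 2)) (x₀ := x)
    (bound := fun s => ‖s ^ (lam - 1 / 2) * (besselDecay lam 1 (√s * (1 + x / 2))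
      * growthMoment lam √s f 2)‖)
    (Ioi_mem_nhds (by linarith)) ?_ ?_ ?_ ?_ ?_ ?_
  · have h2 : besselInvSqrt lam f =ᶠ[𝓝 x] fun x => (1 / (Real.pi * besselWronskian lam))
        * ∫ s in Ioi (0 : ℝ),
          s ^ (lam - 1) * (besselDecay lam 0 (√s * x) * growthMoment lam √s f 2) := by
      filter_upwards [Ioi_mem_nhds hx] with y hy
      exact besselInvSqrt_eq_of_two_lt hlam hf hs hy
    rw [besselRiesz, h2.deriv_eq, (hd.2.const_mul _).deriv, integral_neg, rieszIntegral]
    ring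
  · filter_upwards [Ioi_mem_nhds hx] with y hy
    exact (integrableOn_rpow_mul_besselDecay_mul hlam hC (by linarith) hy hmΨ hM).1
  · exact integrableOn_rpow_mul_besselDecay_mul hlam hC (by linarith) hx hmΨ hM
  · exact (integrableOn_rieszIntegrand hlam hx hmΨ hM).1.neg
  · filter_upwards [ae_restrict_mem measurableSet_Ioi] with s (hs0 : 0 < s) y (hy : 1 + x / 2 < y)
    have hr : 0 < √s := Real.sqrt_pos.2 hs0
    rw [norm_neg, norm_mul, norm_mul, norm_mul, norm_mul, Real.norm_eq_abs (besselDecay _ _ _),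
      Real.norm_eq_abs (besselDecay _ _ _), abs_of_pos (besselDecay_pos hlam (by nlinarith) 1),
      abs_of_pos (besselDecay_pos hlam (mul_pos hr (by linarith)) 1)]
    have := besselDecay_anti hlam (mul_pos hr (by linarith : 0 < 1 + x / 2))
      (mul_le_mul_of_nonneg_left hy.le hr.le) 1
    gcongr
  · exact (integrableOn_rieszIntegrand hlam hx1 hmΨ hM).norm
  · filter_upwards [ae_restrict_mem measurableSet_Ioi] with s (hs0 : 0 < s) y (hy : 1 + x / 2 < y)
    have hr : 0 < √s := Real.sqrt_pos.2 hs0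
    have h := ((hasDerivAt_besselDecay_comp_mul hlam hr (by linarith : 0 < y) 0).mul_const
      (growthMoment lam √s f 2)).const_mul (s ^ (lam - 1))
    refine h.congr_deriv ?_
    have e1 : s ^ (lam - 1 / 2) = s ^ (lam - 1) * √s := by
      rw [Real.sqrt_eq_rpow, ← Real.rpow_add hs0]
      congr 1
      ring
    rw [e1]
    ring

theorem growthMoment_two_mono (hlam : 0 < lam) {g : ℝ → ℝ} (hf : ContinuousOn f (Ioi 0))
    (hg : ContinuousOn g (Ioi 0)) {j k : ℝ}
    (h : ∀ y ∈ Icc (1 : ℝ) 2, besselGrowth lam 0 (j * y) * f y ≤ besselGrowth lam 0 (k * y) * g y) :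
    growthMoment lam j f 2 ≤ growthMoment lam k g 2 := by
  have hsub : uIcc (1 : ℝ) 2 ⊆ Ioi 0 := fun y hy => lt_of_lt_of_le (by norm_num) hy.1
  refine intervalIntegral.integral_mono_on one_le_two
    ((continuousOn_growthMoment_integrand hlam hf).mono hsub).intervalIntegrable
    ((continuousOn_growthMoment_integrand hlam hg).mono hsub).intervalIntegrable fun y hy => ?_
  exact mul_le_mul_of_nonneg_right (h y hy) (Real.rpow_nonneg (by linarith [hy.1]) _)

theorem rieszIntegral_mono (hlam : 0 < lam) {g : ℝ → ℝ} (hf : ContinuousOn f (Ioi 0))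
    (hg : ContinuousOn g (Ioi 0)) (hfm : Measurable f) (hgm : Measurable g)
    (h : ∀ y ∈ Icc (1 : ℝ) 2, f y ≤ g y) {x : ℝ} (hx : 2 < x) :
    rieszIntegral lam f x ≤ rieszIntegral lam g x := by
  obtain ⟨M, -, hM⟩ := exists_abs_growthMoment_two_le hlam hf
  obtain ⟨N, -, hN⟩ := exists_abs_growthMoment_two_le hlam hg
  refine setIntegral_mono_on
    (integrableOn_rieszIntegrand hlam hx (measurable_growthMoment_two hlam hfm) hM)
    (integrableOn_rieszIntegrand hlam hx (measurable_growthMoment_two hlam hgm) hN)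
    measurableSet_Ioi fun s (hs : 0 < s) => ?_
  have hD := besselDecay_pos hlam (mul_pos (Real.sqrt_pos.2 hs) (by linarith : 0 < x)) 1
  have hΨ := growthMoment_two_mono (j := √s) (k := √s) hlam hf hg fun y hy =>
    mul_le_mul_of_nonneg_left (h y hy) (besselGrowth_zero_pos hlam _).le
  have := Real.rpow_pos_of_pos hs (lam - 1 / 2)
  gcongr

theorem rieszIntegral_const_mul (c x : ℝ) :
    rieszIntegral lam (fun y => c * f y) x = c * rieszIntegral lam f x := by
  have h : ∀ k, growthMoment lam k (fun y => c * f y) 2 = c * growthMoment lam k f 2 := fun k => by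
    rw [growthMoment, growthMoment, ← intervalIntegral.integral_const_mul]
    congr 1
    ext y
    ring
  rw [rieszIntegral, rieszIntegral, ← integral_const_mul]
  congr 1
  ext s
  rw [h]
  ring

/-- The substitution `s ↦ s / x²` gives the homogeneity of the leading part of the kernel. -/
theorem integral_rpow_mul_besselDecay_sqrt_mul {x : ℝ} (hx : 0 < x) :
    ∫ s in Ioi (0 : ℝ), s ^ (lam - 1 / 2) * besselDecay lam 1 (√s * x)
      = x ^ (-(2 * lam + 1)) * ∫ s in Ioi (0 : ℝ), s ^ (lam - 1 / 2) * besselDecay lam 1 √s := by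
  have h := integral_comp_mul_left_Ioi (fun s => s ^ (lam - 1 / 2) * besselDecay lam 1 √s) 0
    (pow_pos hx 2)
  rw [mul_zero, smul_eq_mul] at h
  have e1 : (x ^ 2) ^ (lam - 1 / 2) = x ^ (2 * lam - 1) := by
    rw [← Real.rpow_two, ← Real.rpow_mul hx.le]
    congr 1
    ring
  have h2 : ∫ s in Ioi (0 : ℝ), (x ^ 2 * s) ^ (lam - 1 / 2) * besselDecay lam 1 √(x ^ 2 * s)
      = x ^ (2 * lam - 1)
        * ∫ s in Ioi (0 : ℝ), s ^ (lam - 1 / 2) * besselDecay lam 1 (√s * x) := by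
    rw [← integral_const_mul]
    refine setIntegral_congr_fun measurableSet_Ioi fun s (hs : 0 < s) => ?_
    rw [Real.mul_rpow (by positivity) hs.le, e1, Real.sqrt_mul (by positivity), Real.sqrt_sq hx.le,
      mul_comm x]
    ring
  rw [h2] at h
  have e2 : x ^ (-(2 * lam + 1)) = (x ^ 2)⁻¹ * (x ^ (2 * lam - 1))⁻¹ := by
    rw [← Real.rpow_two, ← Real.rpow_neg hx.le, ← Real.rpow_neg hx.le, ← Real.rpow_add hx]
    congr 1
    ring
  rw [e2, mul_right_comm, ← h]
  rw [mul_right_comm, mul_inv_cancel₀ (Real.rpow_pos_of_pos hx (2 * lam - 1)).ne', one_mul]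

/-- For a nonnegative `f`, `-R f(x)` is at least of order `x ^ (-(2 λ + 1))` at infinity: since
`ψ ≥ ψ(0)`, the factor `ψ(√s y)` of the kernel can be replaced by the constant `ψ(0)`, which leaves
a homogeneous integral. -/
theorem exists_le_rieszIntegral (hlam : 0 < lam) (hf : ContinuousOn f (Ioi 0)) (hm : Measurable f)
    (hf0 : ∀ x, 0 ≤ f x) (hpos : ∀ x ∈ Ioo (1 : ℝ) 2, 0 < f x) :
    ∃ c : ℝ, 0 < c ∧ ∀ x : ℝ, 2 < x → c * x ^ (-(2 * lam + 1)) ≤ rieszIntegral lam f x := by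
  have hG := besselGrowth_zero_zero_pos hlam
  obtain ⟨M, -, hM⟩ := exists_abs_growthMoment_two_le hlam hf
  have hΨ : 0 < growthMoment lam 0 f 2 := by
    have hsub : uIcc (1 : ℝ) 2 ⊆ Ioi 0 := fun y hy => lt_of_lt_of_le (by norm_num) hy.1
    refine intervalIntegral.intervalIntegral_pos_of_pos_on
      ((continuousOn_growthMoment_integrand hlam hf).mono hsub).intervalIntegrable
      (fun y hy => ?_) one_lt_two
    have h1 := besselGrowth_zero_pos hlam (0 * y)
    have h2 : 0 < y ^ (2 * lam) := Real.rpow_pos_of_pos (by linarith [hy.1]) _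
    have h3 := hpos y hy
    positivity
  have hi : ∀ x : ℝ, 2 < x →
      IntegrableOn (fun s => s ^ (lam - 1 / 2) * besselDecay lam 1 (√s * x)) (Ioi 0) := by
    intro x hx
    have h := integrableOn_rieszIntegrand (g := fun _ => 1) (M := 1) hlam hx measurable_const
      fun k hk => by
        rw [abs_one, one_mul]
        exact Real.one_le_exp (by linarith)
    simpa using h
  have hJ : 0 < ∫ s in Ioi (0 : ℝ), s ^ (lam - 1 / 2) * besselDecay lam 1 √s := by
    have h3 : 0 < ∫ s in Ioi (0 : ℝ), s ^ (lam - 1 / 2) * besselDecay lam 1 (√s * 3) := by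
      have hp : ∀ s ∈ Ioi (0 : ℝ), 0 < s ^ (lam - 1 / 2) * besselDecay lam 1 (√s * 3) :=
        fun s hs => mul_pos (Real.rpow_pos_of_pos hs _)
          (besselDecay_pos hlam (mul_pos (Real.sqrt_pos.2 hs) (by norm_num)) 1)
      rw [setIntegral_pos_iff_support_of_nonneg_ae
        ((ae_restrict_mem measurableSet_Ioi).mono fun t ht => (hp t ht).le) (hi 3 (by norm_num))]
      exact lt_of_lt_of_le (b := volume (Ioi (0 : ℝ))) (by simp)
        (measure_mono fun t ht => ⟨(hp t ht).ne', ht⟩)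
    rw [integral_rpow_mul_besselDecay_sqrt_mul (by norm_num)] at h3
    exact pos_of_mul_pos_right h3 (by positivity)
  refine ⟨growthMoment lam 0 f 2
    * ∫ s in Ioi (0 : ℝ), s ^ (lam - 1 / 2) * besselDecay lam 1 √s, mul_pos hΨ hJ, fun x hx => ?_⟩
  rw [mul_assoc, mul_comm _ (x ^ (-(2 * lam + 1))),
    ← integral_rpow_mul_besselDecay_sqrt_mul (by linarith), ← integral_const_mul]
  refine setIntegral_mono_on ((hi x hx).const_mul _)
    (integrableOn_rieszIntegrand hlam hx (measurable_growthMoment_two hlam hm) hM)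
    measurableSet_Ioi fun s (hs : 0 < s) => ?_
  have hD := besselDecay_pos hlam (mul_pos (Real.sqrt_pos.2 hs) (by linarith : 0 < x)) 1
  have hle := growthMoment_two_mono (j := 0) (k := √s) hlam hf hf fun y _ =>
    mul_le_mul_of_nonneg_right (by rw [zero_mul]; exact besselGrowth_zero_le hlam _) (hf0 y)
  have := Real.rpow_pos_of_pos hs (lam - 1 / 2)
  calc growthMoment lam 0 f 2 * (s ^ (lam - 1 / 2) * besselDecay lam 1 (√s * x))
      = s ^ (lam - 1 / 2) * (besselDecay lam 1 (√s * x) * growthMoment lam 0 f 2) := by ring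
    _ ≤ _ := by gcongr

end

/-! ### Failure of the weak type bound -/

/-- The function `x ^ (-(2 λ + 1)) log x` is too large at infinity for weak `L¹(μ)`: on `(a, 2 a)`
it exceeds its homogeneous part by the factor `log a`. -/
theorem not_isBesselWeakTypeOne_of_le {lam K : ℝ} (hlam : 0 < lam) (hK : 0 < K)
    {T : (ℝ → ℝ) → ℝ → ℝ} {f : ℝ → ℝ} (hf : IsBddCompactSupp f)
    (hint : Integrable f (besselMeasure lam))
    (hT : ∀ x : ℝ, 2 < x →
      K * ((Real.log x - Real.log 2) * x ^ (-(2 * lam + 1))) ≤ |T f x|) :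
    ¬ IsBesselWeakTypeOne lam T := by
  rintro ⟨C, hC⟩
  set m := 2 * lam + 1 with hm
  have hm0 : 0 < m := by linarith
  set L := ∫⁻ x, ENNReal.ofReal |f x| ∂(besselMeasure lam) with hL
  have hLtop : L ≠ ⊤ := hint.abs.lintegral_lt_top.ne
  set A : ℝ := (C * L).toReal with hA
  have hCL : (C : ℝ≥0∞) * L = ENNReal.ofReal A :=
    (ENNReal.ofReal_toReal (ENNReal.mul_ne_top ENNReal.coe_ne_top hLtop)).symm
  have hA0 : 0 ≤ A := ENNReal.toReal_nonneg
  set ε : ℝ := 1 - 2 ^ (-m) with hε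
  have hε0 : 0 < ε := sub_pos.2 (Real.rpow_lt_one_of_one_lt_of_neg one_lt_two (by linarith))
  -- For this `N`, the weak type bound on `(a, 2 a)` reads `A + 1 ≤ A`.
  set N : ℝ := (A + 1) * m / (K * ε) with hN
  have hN0 : 0 < N := by positivity
  set a : ℝ := 2 * Real.exp N with ha
  have ha2 : 2 < a := by
    have := Real.one_lt_exp_iff.2 hN0
    linarith
  have ha0 : 0 < a := by linarith
  set X : ℝ := 2 * a with hX
  have hX0 : 0 < X := by positivity
  have hXm : 0 < X ^ m := Real.rpow_pos_of_pos hX0 _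
  set t : ℝ := K * (N * X ^ (-m)) with ht
  have ht0 : 0 < t := by positivity
  have hsub : Ioo a X ⊆ {x | t < |T f x|} := by
    intro x hx
    have hx0 : 0 < x := ha0.trans hx.1
    refine lt_of_lt_of_le ?_ (hT x (ha2.trans hx.1))
    have h1 : N ≤ Real.log x - Real.log 2 := by
      have h := Real.log_le_log ha0 hx.1.le
      rw [ha, Real.log_mul (by norm_num) (Real.exp_pos _).ne', Real.log_exp] at h
      linarith
    have h2 : X ^ (-m) < x ^ (-m) := Real.rpow_lt_rpow_of_neg hx0 hx.2 (by linarith)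
    have h3 : 0 < X ^ (-m) := Real.rpow_pos_of_pos hX0 _
    exact mul_lt_mul_of_pos_left (by nlinarith) hK
  have h1 := (measure_mono hsub).trans (hC f hf t ht0)
  rw [besselMeasure_Ioo hlam ha0.le (by linarith), hCL, ← ENNReal.ofReal_div_of_pos ht0,
    ENNReal.ofReal_le_ofReal_iff (by positivity)] at h1
  have e1 : a ^ m = X ^ m * 2 ^ (-m) := by
    rw [hX, Real.mul_rpow (by norm_num) ha0.le, mul_right_comm, ← Real.rpow_add two_pos,
      add_neg_cancel, Real.rpow_zero, one_mul]
  have e2 : X ^ m - a ^ m = X ^ m * ε := by rw [e1, hε]; ring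
  rw [e2, ht, Real.rpow_neg hX0.le, div_le_div_iff₀ hm0 (by positivity)] at h1
  have e3 : X ^ m * ε * (K * (N * (X ^ m)⁻¹)) = (A + 1) * m := by
    rw [hN]
    field_simp
  rw [e3] at h1
  nlinarith

/-- A continuous bump supported in `[1, 2]`. -/
def bump (x : ℝ) : ℝ := max 0 ((x - 1) * (2 - x))

theorem continuous_bump : Continuous bump := by
  unfold bump
  fun_prop

theorem bump_eq_zero {x : ℝ} (hx : x ∉ Icc (1 : ℝ) 2) : bump x = 0 := by
  refine max_eq_left ?_
  rw [mem_Icc, not_and_or, not_le, not_le] at hx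
  rcases hx with h | h <;> nlinarith

theorem bump_pos {x : ℝ} (hx : x ∈ Ioo (1 : ℝ) 2) : 0 < bump x :=
  lt_max_of_lt_right (mul_pos (by linarith [hx.1]) (by linarith [hx.2]))

theorem bump_nonneg (x : ℝ) : 0 ≤ bump x := le_max_left _ _

theorem isBddCompactSupp_bump : IsBddCompactSupp bump := by
  refine ⟨continuous_bump.measurable, ⟨1, fun x => ?_⟩, 1, 2, one_pos, fun x hx => bump_eq_zero hx⟩
  rw [abs_of_nonneg (bump_nonneg x)]
  exact max_le zero_le_one (by nlinarith [sq_nonneg (x - 3 / 2)])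

theorem integrable_bump (lam : ℝ) : Integrable bump (besselMeasure lam) :=
  integrable_besselMeasure_iff.2 (integrableOn_Ioi_of_support_subset
    (continuous_bump.continuousOn.mul (continuousOn_rpow_Ioi _)) fun x hx => by
      rw [bump_eq_zero hx, zero_mul])

/-- Write `b = log (x ^ (2 λ))`. As the kernel of `R` has constant sign and `b ≤ 2 λ log 2` on the
support of the bump `f`, `R (b f)` is dominated by `2 λ log 2 · R f`, and `b R f` prevails. -/
theorem exists_le_abs_besselCommutator_log_bump {lam : ℝ} (hlam : 0 < lam) :
    ∃ K : ℝ, 0 < K ∧ ∀ x : ℝ, 2 < x →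
      K * ((Real.log x - Real.log 2) * x ^ (-(2 * lam + 1)))
        ≤ |besselCommutator lam (fun y => Real.log (y ^ (2 * lam))) bump x| := by
  have hW := besselWronskian_pos hlam
  have hfc : ContinuousOn bump (Ioi 0) := continuous_bump.continuousOn
  have hfm := continuous_bump.measurable
  obtain ⟨c, hc, hle⟩ := exists_le_rieszIntegral hlam hfc hfm bump_nonneg fun _ => bump_pos
  set g : ℝ → ℝ := fun y => Real.log (y ^ (2 * lam)) * bump y with hg
  have hgc : ContinuousOn g (Ioi 0) := ContinuousOn.mul
    ((continuousOn_rpow_Ioi _).log fun y hy => (Real.rpow_pos_of_pos hy _).ne') hfc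
  have hgm : Measurable g :=
    (Real.measurable_log.comp (measurable_id.pow_const _)).mul hfm
  have hgs : ∀ x, x ∉ Icc (1 : ℝ) 2 → g x = 0 := fun x hx => by
    simp only [hg, bump_eq_zero hx, mul_zero]
  have hgle : ∀ y ∈ Icc (1 : ℝ) 2, g y ≤ 2 * lam * Real.log 2 * bump y := by
    intro y hy
    have hy0 : 0 < y := by linarith [hy.1]
    simp only [hg, Real.log_rpow hy0]
    have := Real.log_le_log hy0 hy.2
    have := bump_nonneg y
    gcongr
  set κ : ℝ := 1 / (Real.pi * besselWronskian lam) with hκ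
  have hκ0 : 0 < κ := by
    have := Real.pi_pos
    positivity
  refine ⟨κ * (2 * lam * c), by positivity, fun x hx => ?_⟩
  have hx0 : 0 < x := by linarith
  have h1 : rieszIntegral lam g x ≤ 2 * lam * Real.log 2 * rieszIntegral lam bump x := by
    rw [← rieszIntegral_const_mul]
    exact rieszIntegral_mono hlam hgc (continuousOn_const.mul hfc) hgm (hfm.const_mul _) hgle hx
  have h2 := hle x hx
  have h3 : 0 ≤ Real.log x - Real.log 2 := sub_nonneg.2 (Real.log_le_log two_pos hx.le)
  have h4 : (Real.log x - Real.log 2) * (c * x ^ (-(2 * lam + 1)))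
      ≤ (Real.log x - Real.log 2) * rieszIntegral lam bump x := by gcongr
  rw [besselCommutator, besselRiesz_eq_of_two_lt hlam hfc (fun _ => bump_eq_zero) hfm hx,
    besselRiesz_eq_of_two_lt hlam hgc hgs hgm hx, ← hκ, Real.log_rpow hx0]
  refine le_trans ?_ (neg_le_abs _)
  calc κ * (2 * lam * c) * ((Real.log x - Real.log 2) * x ^ (-(2 * lam + 1)))
      = κ * (2 * lam * ((Real.log x - Real.log 2) * (c * x ^ (-(2 * lam + 1))))) := by ring
    _ ≤ κ * (2 * lam * ((Real.log x - Real.log 2) * rieszIntegral lam bump x)) := by gcongr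
    _ = κ * (2 * lam * Real.log x * rieszIntegral lam bump x
          - 2 * lam * Real.log 2 * rieszIntegral lam bump x) := by ring
    _ ≤ κ * (2 * lam * Real.log x * rieszIntegral lam bump x - rieszIntegral lam g x) := by gcongr
    _ = _ := by ring

end

/-- For every `λ > 0`, the function `b₀(x) = log (x ^ (2 λ))` belongs to the `BMO` space of the
Bessel operator, and its commutator with the Bessel Riesz transform is not of weak type `(1, 1)`. -/
theorem mainTheorem8 (lam : ℝ) (hlam : 0 < lam) :
    ∃ b₀ : ℝ → ℝ, (∀ x : ℝ, 0 < x → b₀ x = Real.log (x ^ (2 * lam))) ∧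
      MemBesselBMO lam b₀ ∧ ¬ IsBesselWeakTypeOne lam (besselCommutator lam b₀) := by
  obtain ⟨K, hK, h⟩ := exists_le_abs_besselCommutator_log_bump hlam
  exact ⟨fun x => Real.log (x ^ (2 * lam)), fun _ _ => rfl, memBesselBMO_log_rpow hlam,
    not_isBesselWeakTypeOne_of_le hlam hK isBddCompactSupp_bump (integrable_bump lam) h⟩
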